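/- For a phase $S$ and a cutoff $\psi\in C_0^\infty(\mathbb R^3)$ (real- or complex-valued), where $S$ is real-valued and $C^\infty$ (for instance real-analytic) on an open set containing $\operatorname{supp}\psi$, for $\lambda\in\mathbb R$ and $f_1,f_2,f_3:\mathbb R^2\to\mathbb C$, let $$\Lambda_3(f_1,f_2,f_3)=\int_{\mathbb R^3}e^{i\lambda S(x)}\psi(x)\,f_1(x_2,x_3)\,f_2(x_1,x_3)\,f_3(x_1,x_2)\,dx .$$ Let $D_3=\partial_{x_1}\partial_{x_2}\partial_{x_3}$. Given $\mu>0$ and $b_j>0$, we say that $\Lambda_3$ satisfies the local estimate hypotheses in $x_j$ with parameter $\mu$, width $b_j$ and constants $C_1,C_2>0$ if (1) $\psi$ is supported on a rectangle (with sides parallel to the axes) of width $b_j$ in the $x_j$-direction; (2) $|\partial_{x_j}^n\psi|\le C_1b_j^{-n}$ for $n=0,1,2$; (3) $|D_3S|\ge\mu$, $|\partial_{x_j}D_3S|\le C_2\mu b_j^{-1}$ and $|\partial_{x_j}^2D_3S|\le C_2\mu b_j^{-2}$ on $\operatorname{supp}\psi$. **Corollary.** For all $C_1,C_2>0$ there is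 a constant $C>0$, depending only on $C_1$ and $C_2$, such that the following holds. Let $\mu>0$, $b_1,b_2,b_3>0$ and $\lambda\in\mathbb R\setminus\{0\}$. Suppose that, for each $j=1,2,3$, $\Lambda_3$ satisfies the local estimate hypotheses in $x_j$ with parameter $\mu$, width $b_j$ and constants $C_1,C_2$, and that $\psi$ is supported on a rectangle of dimensions $b_1\times b_2\times b_3$. Then for all $f_1,f_2\in L^4(\mathbb R^2)$ and $f_3\in L^2(\mathbb R^2)$ the integral defining $\Lambda_3(f_1,f_2,f_3)$ converges absolutely and $$|\Lambda_3(f_1,f_2,f_3)|\le C\,b_3^{1/4}\,(|\lambda|\mu)^{-1/4}\,\|f_1\|_{L^4}\,\|f_2\|_{L^4}\,\|f_3\|_{L^2}.$$ -/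

import Mathlib

open MeasureTheory
open scoped ContDiff

/-- The partial derivative `∂_j g`: the derivative of `g` in the direction of the `j`-th
coordinate vector. -/
noncomputable def coordDeriv {d : ℕ} {F : Type*} [NormedAddCommGroup F] [NormedSpace ℝ F]
    (j : Fin d) (g : (Fin d → ℝ) → F) : (Fin d → ℝ) → F :=
  fun x => lineDeriv ℝ g x (Pi.single j 1)

/-- The operator `D_d = ∂_1 ∂_2 ⋯ ∂_d` on functions of `d` real variables. -/
noncomputable def fullMixedDeriv {d : ℕ} (S : (Fin d → ℝ) → ℝ) : (Fin d → ℝ) → ℝ :=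
  (List.finRange d).foldr (fun j g => coordDeriv j g) S

/-- The integrand `e^{i λ S(x)} ψ(x) ∏_j f_j(π_j(x))` of the Loomis-Whitney form in dimension
`n + 1`, where `π_j` deletes the `j`-th coordinate. -/
noncomputable def loomisWhitneyIntegrand {n : ℕ} (lam : ℝ) (S : (Fin (n + 1) → ℝ) → ℝ)
    (ψ : (Fin (n + 1) → ℝ) → ℂ) (f : Fin (n + 1) → (Fin n → ℝ) → ℂ)
    (x : Fin (n + 1) → ℝ) : ℂ :=
  Complex.exp (Complex.I * ((lam * S x : ℝ) : ℂ)) * ψ x * ∏ j, f j (j.removeNth x)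

/-- The oscillatory Loomis-Whitney form `Λ_d(f_1, …, f_d)` in dimension `d = n + 1`. -/
noncomputable def loomisWhitneyForm {n : ℕ} (lam : ℝ) (S : (Fin (n + 1) → ℝ) → ℝ)
    (ψ : (Fin (n + 1) → ℝ) → ℂ) (f : Fin (n + 1) → (Fin n → ℝ) → ℂ) : ℂ :=
  ∫ x, loomisWhitneyIntegrand lam S ψ f x

/-- The local estimate hypotheses in `x_j` with parameter `μ`, for the phase `S` and the cutoff
`ψ`, with width `b` in the `x_j`-direction and constants `C₁`, `C₂`. -/
structure LocalEstimateHypotheses {d : ℕ} (S : (Fin d → ℝ) → ℝ) (ψ : (Fin d → ℝ) → ℂ)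
    (j : Fin d) (b μ C₁ C₂ : ℝ) : Prop where
  /-- `ψ` is supported on a rectangle of width `b` in the `x_j`-direction. -/
  support_subset : ∃ l u : Fin d → ℝ, u j - l j = b ∧ tsupport ψ ⊆ Set.Icc l u
  /-- Bounds on the cutoff. -/
  cutoff_bound : ∀ n : ℕ, n ≤ 2 → ∀ x, ‖((coordDeriv j)^[n] ψ) x‖ ≤ C₁ * b ^ (-(n : ℤ))
  /-- Bounds on the phase, in the support of the cutoff. -/
  le_phase : ∀ x ∈ tsupport ψ, μ ≤ |fullMixedDeriv S x|
  phase_bound_one : ∀ x ∈ tsupport ψ,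
    |coordDeriv j (fullMixedDeriv S) x| ≤ C₂ * μ * b ^ (-1 : ℤ)
  phase_bound_two : ∀ x ∈ tsupport ψ,
    |coordDeriv j (coordDeriv j (fullMixedDeriv S)) x| ≤ C₂ * μ * b ^ (-2 : ℤ)

/-! Write x, y, z for the coordinates, so that the three functions are F(y,z), G(x,z) and H(x,y).
Cauchy-Schwarz against H and a T T* step in z remove H; Cauchy-Schwarz in y against F(y,z) times the
conjugate of F(y,z'), and a T T* step in x, remove F. What is left is an integral in y of four
kernels, whose phase is λ times the second difference of S between x, x' and z, z'. If the whole
rectangle spanned by (x,z) and (x',z') lies in the support of ψ, the mean value theorem writes the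
y-derivative of that difference as (x - x')(z - z') D₃S at some point, hence at least μ|x - x'||z -
z'| in modulus; the next two y-derivatives are controlled in the same way. Two integrations by parts
then give a decaying kernel (`norm_integral_exp_mul_le`). Integrating it in x' leaves a multiple of
1/|z - z'|, whose square root |z - z'|^(-1/2) is locally integrable, and Schur's test in z produces
the L⁴ norms of F and G (`enorm_trilinear_le`).

The obstacle is that the support of ψ need not contain such rectangles. So ψ is split into pieces on
which |ψ| is comparable to C₁δ, with δ = 2^(-k). Where |ψ| is that large, the first-derivative
bounds keep ψ nonzero on nearby rectangles with sides of order `b 0 * δ` and `b 2 * δ`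
(`AdmissiblePair.mem_support_of_lt`), so the argument applies on cells of this size. A piece has
size of order δ and varies in y at scale `δ * b 1`.

For the fourth power of the form, the four amplitudes give δ⁴, the shorter scale in y costs δ⁻¹,
Schur's test on a short z-interval gains δ, and summing over the cells costs δ⁻³
(`sum_sum_pow_four_le`). The net factor is δ, and its fourth root is summable over k. The sum over
levels is carried out for bounded functions, where the remainder tends to 0 trivially; truncation
then removes boundedness. -/

open scoped ENNReal

/-! ### Non-stationary phase in one variable -/

/-- `u` is twice differentiable, of size `a`, and varies at scale `l`. -/
def HasScaleBound (u : ℝ → ℂ) (a l : ℝ) (u₁ u₂ : ℝ → ℂ) : Prop :=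
  (∀ t, HasDerivAt u (u₁ t) t) ∧ (∀ t, HasDerivAt u₁ (u₂ t) t) ∧
    (∀ t, ‖u t‖ ≤ a) ∧ (∀ t, ‖u₁ t‖ ≤ a / l) ∧ (∀ t, ‖u₂ t‖ ≤ a / l ^ 2)

/-- The Leibniz rule for the second derivative has four terms, each at most a a' / l²; the factor 4
covers all three bounds at once. -/
theorem HasScaleBound.mul {u v u₁ u₂ v₁ v₂ : ℝ → ℂ} {a a' l : ℝ}
    (hu : HasScaleBound u a l u₁ u₂) (hv : HasScaleBound v a' l v₁ v₂) :
    HasScaleBound (fun t => u t * v t) (4 * (a * a')) l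
      (fun t => u₁ t * v t + u t * v₁ t)
      (fun t => u₂ t * v t + u₁ t * v₁ t + (u₁ t * v₁ t + u t * v₂ t)) := by
  obtain ⟨h1, h2, h3, h4, h5⟩ := hu
  obtain ⟨g1, g2, g3, g4, g5⟩ := hv
  have ha : 0 ≤ a := (norm_nonneg _).trans (h3 0)
  have ha' : 0 ≤ a' := (norm_nonneg _).trans (g3 0)
  have hb : 0 ≤ a / l := (norm_nonneg _).trans (h4 0)
  have hb' : 0 ≤ a' / l := (norm_nonneg _).trans (g4 0)
  have hc : 0 ≤ a / l ^ 2 := (norm_nonneg _).trans (h5 0)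
  refine ⟨fun t => (h1 t).mul (g1 t), fun t => ((h2 t).mul (g1 t)).add ((h1 t).mul (g2 t)),
    fun t => ?_, fun t => ?_, fun t => ?_⟩
  · rw [norm_mul]
    calc _ ≤ a * a' := mul_le_mul (h3 t) (g3 t) (norm_nonneg _) ha
      _ ≤ _ := by nlinarith [mul_nonneg ha ha']
  · refine (norm_add_le _ _).trans ?_
    rw [norm_mul, norm_mul]
    calc _ ≤ a / l * a' + a * (a' / l) := add_le_add
          (mul_le_mul (h4 t) (g3 t) (norm_nonneg _) hb)
          (mul_le_mul (h3 t) (g4 t) (norm_nonneg _) ha)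
      _ = 2 * (a * (a' / l)) := by ring
      _ ≤ 4 * (a * (a' / l)) := by nlinarith [mul_nonneg ha hb']
      _ = _ := by ring
  · refine (norm_add_le _ _).trans ((add_le_add (norm_add_le _ _) (norm_add_le _ _)).trans ?_)
    simp only [norm_mul]
    calc _ ≤ a / l ^ 2 * a' + a / l * (a' / l) + (a / l * (a' / l) + a * (a' / l ^ 2)) := by
          refine add_le_add (add_le_add ?_ ?_) (add_le_add ?_ ?_)
          · exact mul_le_mul (h5 t) (g3 t) (norm_nonneg _) hc
          · exact mul_le_mul (h4 t) (g4 t) (norm_nonneg _) hb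
          · exact mul_le_mul (h4 t) (g4 t) (norm_nonneg _) hb
          · exact mul_le_mul (h3 t) (g5 t) (norm_nonneg _) ha
      _ = _ := by ring

theorem HasScaleBound.conj {u u₁ u₂ : ℝ → ℂ} {a l : ℝ} (hu : HasScaleBound u a l u₁ u₂) :
    HasScaleBound (fun t => starRingEnd ℂ (u t)) a l (fun t => starRingEnd ℂ (u₁ t))
      (fun t => starRingEnd ℂ (u₂ t)) := by
  obtain ⟨h1, h2, h3, h4, h5⟩ := hu
  refine ⟨fun t => (h1 t).star, fun t => (h2 t).star, ?_, ?_, ?_⟩ <;>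
  simpa only [RCLike.norm_conj]

/-- Second-order non-stationary phase: an amplitude `A` of size `a`, varying at scale `l`, and a
phase whose derivative is at least `θ` near the support of `A`. -/
theorem norm_integral_exp_mul_le {A A₁ A₂ : ℝ → ℂ} {v p p₁ p₂ : ℝ → ℝ} {U : Set ℝ}
    {lam a l θ c L R : ℝ} (hlam : lam ≠ 0) (hl : 0 < l) (hθ : 0 < θ) (hc : 0 ≤ c)
    (hL : 0 ≤ L) (hAU : tsupport A ⊆ U) (hA : HasScaleBound A a l A₁ A₂)
    (hsupp : tsupport A ⊆ Set.Icc R (R + L))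
    (hv : ∀ t ∈ U, HasDerivAt v (p t) t) (hp : ∀ t ∈ U, HasDerivAt p (p₁ t) t)
    (hp₁ : ∀ t ∈ U, HasDerivAt p₁ (p₂ t) t) (hpθ : ∀ t ∈ U, θ ≤ |p t|)
    (hp₁θ : ∀ t ∈ U, |p₁ t| ≤ c * θ / l) (hp₂θ : ∀ t ∈ U, |p₂ t| ≤ c * θ / l ^ 2) :
    ‖∫ t, Complex.exp (Complex.I * ((lam * v t : ℝ) : ℂ)) * A t‖ ≤
      (1 + 4 * c + 3 * c ^ 2) * (L * a) / (lam * θ * l) ^ 2 := by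
  obtain ⟨hA0, hA1, hAa, hA₁a, hA₂a⟩ := hA
  have ha : 0 ≤ a := (norm_nonneg _).trans (hAa 0)
  have hz : ∀ t ∉ tsupport A, A =ᶠ[nhds t] 0 := fun t ht =>
    notMem_tsupport_iff_eventuallyEq.1 ht
  have hz₁' : ∀ t ∉ tsupport A, A₁ =ᶠ[nhds t] 0 := fun t ht => by
    filter_upwards [(hz t ht).eventuallyEq_nhds] with s hs
    exact (hA0 s).unique ((hasDerivAt_const s (0 : ℂ)).congr_of_eventuallyEq hs)
  have hz₀ : ∀ t ∉ tsupport A, A t = 0 := fun t ht => (hz t ht).eq_of_nhds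
  have hz₁ : ∀ t ∉ tsupport A, A₁ t = 0 := fun t ht => (hz₁' t ht).eq_of_nhds
  have hz₂ : ∀ t ∉ tsupport A, A₂ t = 0 := fun t ht =>
    (hA1 t).unique ((hasDerivAt_const t (0 : ℂ)).congr_of_eventuallyEq (hz₁' t ht))
  set e : ℝ → ℂ := fun t => Complex.exp (Complex.I * ((lam * v t : ℝ) : ℂ)) with he
  have hen : ∀ t, ‖e t‖ = 1 := fun t => by
    rw [he]; simp only; rw [mul_comm]; exact Complex.norm_exp_ofReal_mul_I _
  set B : ℝ → ℂ := fun t => A t / p t with hB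
  set B₁ : ℝ → ℂ := fun t => A₁ t / p t - A t * p₁ t / (p t) ^ 2 with hB₁
  set D : ℝ → ℂ := fun t => A₁ t / (p t) ^ 2 - A t * p₁ t / (p t) ^ 3 with hD
  set D₁ : ℝ → ℂ := fun t => A₂ t / (p t) ^ 2 - 3 * A₁ t * p₁ t / (p t) ^ 3
    - A t * p₂ t / (p t) ^ 3 + 3 * A t * (p₁ t) ^ 2 / (p t) ^ 4 with hD₁
  set iL : ℂ := Complex.I * lam with hiL
  have hiL0 : iL ≠ 0 := mul_ne_zero Complex.I_ne_zero (by exact_mod_cast hlam)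
  -- `Q` is the boundary term of two integrations by parts, with D = (A/p)'/p. Its derivative is e A
  -- minus the remaining integrand e D' / (iλ)², so compact support makes the two integrals equal.
  set Q : ℝ → ℂ := fun t => e t * (B t / iL - D t / iL ^ 2) with hQ
  have hQz : ∀ t ∉ tsupport A, Q =ᶠ[nhds t] 0 := fun t ht => by
    filter_upwards [hz t ht, hz₁' t ht] with s hs hs'
    simp [hQ, hB, hD, hs, hs']
  have hQd : ∀ t, HasDerivAt Q (e t * A t - e t * D₁ t / iL ^ 2) t := fun t => by
    by_cases ht : t ∈ tsupport A
    · have htU := hAU ht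
      have hpt : (p t : ℂ) ≠ 0 := by
        have := hθ.trans_le (hpθ t htU)
        exact_mod_cast abs_pos.1 this
      have d0 : HasDerivAt e (e t * (iL * p t)) t := by
        have := (((hv t htU).const_mul lam).ofReal_comp.const_mul Complex.I).cexp
        refine this.congr_deriv ?_
        simp only [he, hiL]; push_cast; ring
      have dp := (hp t htU).ofReal_comp
      have dp₁ := (hp₁ t htU).ofReal_comp
      have dB : HasDerivAt B (B₁ t) t := by
        refine ((hA0 t).div dp hpt).congr_deriv ?_
        simp only [hB₁]; field_simp
      have dD : HasDerivAt D (D₁ t) t := by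
        refine (((hA1 t).div (dp.pow 2) (pow_ne_zero _ hpt)).sub
          (((hA0 t).mul dp₁).div (dp.pow 3) (pow_ne_zero _ hpt))).congr_deriv ?_
        simp only [hD₁, Pi.pow_apply, Pi.mul_apply]; field_simp; push_cast; ring
      refine (d0.mul ((dB.div_const iL).sub (dD.div_const (iL ^ 2)))).congr_deriv ?_
      simp only [hB, hB₁, hD, Pi.sub_apply]; field_simp; ring
    · have h0 := (hasDerivAt_const t (0 : ℂ)).congr_of_eventuallyEq (hQz t ht)
      refine h0.congr_deriv ?_
      simp [hD₁, hz₀ t ht, hz₁ t ht, hz₂ t ht]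
  have hS0 : ∀ t ∉ Set.Icc R (R + L), t ∉ tsupport A := fun t ht h => ht (hsupp h)
  have hDb : ∀ t, ‖D₁ t‖ ≤ (1 + 4 * c + 3 * c ^ 2) * a / (θ * l) ^ 2 := fun t => by
    by_cases ht : t ∈ tsupport A
    · have htU := hAU ht
      have hq := hpθ t htU
      have hq0 : 0 < |p t| := hθ.trans_le hq
      have n1 : ‖A₂ t / (p t : ℂ) ^ 2‖ ≤ a / l ^ 2 / θ ^ 2 := by
        rw [norm_div, norm_pow, Complex.norm_real, Real.norm_eq_abs]
        gcongr
        exact hA₂a t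
      have n2 : ‖3 * A₁ t * p₁ t / (p t : ℂ) ^ 3‖ ≤ 3 * (a / l) * (c * θ / l) / θ ^ 3 := by
        simp only [norm_div, norm_mul, norm_pow, Complex.norm_real, Real.norm_eq_abs,
          Complex.norm_ofNat]
        gcongr
        · exact hA₁a t
        · exact hp₁θ t htU
      have n3 : ‖A t * p₂ t / (p t : ℂ) ^ 3‖ ≤ a * (c * θ / l ^ 2) / θ ^ 3 := by
        simp only [norm_div, norm_mul, norm_pow, Complex.norm_real, Real.norm_eq_abs]
        gcongr
        · exact hAa t
        · exact hp₂θ t htU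
      have n4 : ‖3 * A t * (p₁ t) ^ 2 / (p t : ℂ) ^ 4‖ ≤ 3 * a * (c * θ / l) ^ 2 / θ ^ 4 := by
        simp only [norm_div, norm_mul, norm_pow, Complex.norm_real, Real.norm_eq_abs,
          Complex.norm_ofNat]
        gcongr
        · exact hAa t
        · exact hp₁θ t htU
      -- The four terms contribute 1, 3c, c and 3c², in this order.
      calc ‖D₁ t‖ ≤ a / l ^ 2 / θ ^ 2 + 3 * (a / l) * (c * θ / l) / θ ^ 3
            + a * (c * θ / l ^ 2) / θ ^ 3 + 3 * a * (c * θ / l) ^ 2 / θ ^ 4 :=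
            (norm_add_le _ _).trans (add_le_add ((norm_sub_le _ _).trans (add_le_add
              ((norm_sub_le _ _).trans (add_le_add n1 n2)) n3)) n4)
        _ = _ := by field_simp; ring
    · have : D₁ t = 0 := by simp [hD₁, hz₀ t ht, hz₁ t ht, hz₂ t ht]
      rw [this, norm_zero]; positivity
  have hcont : Continuous fun t => e t * A t := by
    refine continuous_iff_continuousAt.2 fun t => ?_
    by_cases ht : t ∈ tsupport A
    · refine ContinuousAt.mul ?_ (hA0 t).continuousAt
      have := (hv t (hAU ht)).continuousAt
      simp only [he]
      fun_prop
    · have : (fun t => e t * A t) =ᶠ[nhds t] 0 := by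
        filter_upwards [hz t ht] with s hs
        simp [hs]
      exact (continuousAt_const (y := (0 : ℂ))).congr this.symm
  have hint : ∀ g : ℝ → ℂ, AEStronglyMeasurable g volume → (∃ M, ∀ t, ‖g t‖ ≤ M) →
      (∀ t ∉ Set.Icc R (R + L), g t = 0) → Integrable g := by
    rintro g hg ⟨M, hM⟩ h0
    rw [← integrableOn_iff_integrable_of_support_subset (s := Set.Icc R (R + L))
      (fun t ht => by_contra fun h => ht (h0 t h))]
    exact Measure.integrableOn_of_bounded (M := M) (by simp) hg
      (Filter.Eventually.of_forall hM)
  have hI1 : Integrable fun t => e t * A t := by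
    refine hint _ hcont.aestronglyMeasurable ⟨a, fun t => ?_⟩ fun t ht => ?_
    · rw [norm_mul, hen, one_mul]; exact hAa t
    · rw [hz₀ t (hS0 t ht), mul_zero]
  have hI2 : Integrable fun t => e t * D₁ t / iL ^ 2 := by
    refine hint _ ?_ ⟨(1 + 4 * c + 3 * c ^ 2) * a / (θ * l) ^ 2 / ‖iL ^ 2‖, fun t => ?_⟩
      fun t ht => ?_
    -- Neither `A₂` nor `p₂` is assumed measurable. Measurability comes from writing this function
    -- as a continuous function minus a derivative.
    · have h1 : (fun t => e t * D₁ t / iL ^ 2) = fun t => e t * A t - deriv Q t := by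
        funext t; rw [(hQd t).deriv]; ring
      rw [h1]
      exact hcont.aestronglyMeasurable.sub (aestronglyMeasurable_deriv _ _)
    · rw [norm_div, norm_mul, hen, one_mul]; gcongr; exact hDb t
    · have ht := hS0 t ht
      simp [hD₁, hz₀ t ht, hz₁ t ht, hz₂ t ht]
  have hIQ : Integrable Q := by
    have hQc : Continuous Q := continuous_iff_continuousAt.2 fun t => (hQd t).continuousAt
    refine hQc.integrable_of_hasCompactSupport ?_
    refine HasCompactSupport.intro (isCompact_Icc (a := R) (b := R + L)) fun t ht => ?_
    exact (hQz t (hS0 t ht)).eq_of_nhds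
  have hzero := integral_eq_zero_of_hasDerivAt_of_integrable hQd (hI1.sub hI2) hIQ
  rw [integral_sub hI1 hI2, sub_eq_zero] at hzero
  rw [hzero]
  have hset : ∫ t, e t * D₁ t / iL ^ 2 = ∫ t in Set.Icc R (R + L), e t * D₁ t / iL ^ 2 := by
    refine (setIntegral_eq_integral_of_forall_compl_eq_zero fun t ht => ?_).symm
    have ht := hS0 t ht
    simp [hD₁, hz₀ t ht, hz₁ t ht, hz₂ t ht]
  rw [hset]
  have hiLn : ‖iL ^ 2‖ = lam ^ 2 := by
    rw [norm_pow, hiL, norm_mul, Complex.norm_I, one_mul, Complex.norm_real, Real.norm_eq_abs,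
      sq_abs]
  refine (norm_setIntegral_le_of_norm_le_const
    (C := (1 + 4 * c + 3 * c ^ 2) * a / (θ * l) ^ 2 / lam ^ 2) (by simp) fun t _ => ?_).trans ?_
  · rw [norm_div, norm_mul, hen, one_mul, hiLn]; gcongr; exact hDb t
  · rw [Real.volume_real_Icc_of_le (by linarith)]
    apply le_of_eq
    field_simp
    ring

/-! ### Schur's test and the twice iterated T T* argument -/

/-- Cauchy-Schwarz for Lebesgue integrals, in a square-root-free form. -/
theorem lintegral_sq_le_of_sq_le_mul {α : Type*} [MeasurableSpace α] {μ : Measure α}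
    {w f g : α → ℝ≥0∞} (hf : AEMeasurable f μ) (hg : AEMeasurable g μ)
    (h : ∀ᵐ x ∂μ, w x ^ 2 ≤ f x * g x) :
    (∫⁻ x, w x ∂μ) ^ 2 ≤ (∫⁻ x, f x ∂μ) * ∫⁻ x, g x ∂μ := by
  have hr : ∀ y : ℝ≥0∞, (y ^ (1 / 2 : ℝ)) ^ (2 : ℝ) = y := fun y => by
    rw [← ENNReal.rpow_mul]; norm_num
  have hr' : ∀ y : ℝ≥0∞, (y ^ (1 / 2 : ℝ)) ^ (2 : ℕ) = y := fun y => by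
    rw [← ENNReal.rpow_natCast]; exact_mod_cast hr y
  have hw : ∀ᵐ x ∂μ, w x ≤ f x ^ (1 / 2 : ℝ) * g x ^ (1 / 2 : ℝ) := by
    filter_upwards [h] with x h
    rw [← ENNReal.mul_rpow_of_nonneg _ _ (by norm_num)]
    calc w x = (w x ^ (2 : ℝ)) ^ (1 / 2 : ℝ) := by rw [← ENNReal.rpow_mul]; norm_num
      _ ≤ _ := ENNReal.rpow_le_rpow (by exact_mod_cast h) (by norm_num)
  have h2 := ENNReal.lintegral_mul_le_Lp_mul_Lq μ (p := 2) (q := 2)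
    (Real.HolderConjugate.two_two) (hf.pow_const (1 / 2 : ℝ)) (hg.pow_const (1 / 2 : ℝ))
  simp only [hr] at h2
  calc _ ≤ ((∫⁻ x, f x ∂μ) ^ (1 / 2 : ℝ) * (∫⁻ x, g x ∂μ) ^ (1 / 2 : ℝ)) ^ 2 :=
        pow_le_pow_left' ((lintegral_mono_ae hw).trans h2) 2
    _ = _ := by rw [mul_pow, hr', hr']

theorem ENNReal.two_mul_mul_le_sq_add_sq (a b : ℝ≥0∞) : 2 * (a * b) ≤ a ^ 2 + b ^ 2 := by
  rcases eq_or_ne a ⊤ with rfl | ha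
  · simp
  rcases eq_or_ne b ⊤ with rfl | hb
  · simp
  lift a to NNReal using ha
  lift b to NNReal using hb
  norm_cast
  have := two_mul_le_add_sq a b
  calc 2 * (a * b) = 2 * a * b := by ring
    _ ≤ _ := this

/-- Schur's test for a symmetric kernel. -/
theorem lintegral_lintegral_mul_mul_le {α : Type*} [MeasurableSpace α] {μ : Measure α}
    [SFinite μ] {k : α → α → ℝ≥0∞} {C : ℝ≥0∞} (hk : Measurable (Function.uncurry k))
    (hsymm : ∀ x y, k x y = k y x) (hC : ∀ x, ∫⁻ y, k x y ∂μ ≤ C) {g : α → ℝ≥0∞}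
    (hg : Measurable g) :
    ∫⁻ x, ∫⁻ y, g x * g y * k x y ∂μ ∂μ ≤ C * ∫⁻ x, g x ^ 2 ∂μ := by
  have h1 : ∫⁻ x, ∫⁻ y, g x ^ 2 * k x y ∂μ ∂μ ≤ C * ∫⁻ x, g x ^ 2 ∂μ := by
    rw [← lintegral_const_mul _ (hg.pow_const 2)]
    refine lintegral_mono fun x => ?_
    have hkx : Measurable fun y => k x y := hk.comp measurable_prodMk_left
    rw [lintegral_const_mul _ hkx, mul_comm]
    exact mul_le_mul_left (hC x) _
  have h2 : ∫⁻ x, ∫⁻ y, g y ^ 2 * k x y ∂μ ∂μ = ∫⁻ x, ∫⁻ y, g x ^ 2 * k x y ∂μ ∂μ := by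
    rw [lintegral_lintegral_swap]
    · simp only [hsymm]
    · exact (((hg.comp measurable_snd).pow_const 2).mul hk).aemeasurable
  -- The arithmetic-geometric mean inequality separates g x from g y; by symmetry of the kernel both
  -- resulting integrals agree.
  have h3 : 2 * ∫⁻ x, ∫⁻ y, g x * g y * k x y ∂μ ∂μ ≤
      ∫⁻ x, ∫⁻ y, g x ^ 2 * k x y ∂μ ∂μ + ∫⁻ x, ∫⁻ y, g y ^ 2 * k x y ∂μ ∂μ := by
    have hm : Measurable fun p : α × α => g p.1 ^ 2 * k p.1 p.2 :=
      ((hg.comp measurable_fst).pow_const 2).mul hk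
    rw [← lintegral_add_left hm.lintegral_prod_right', ← lintegral_const_mul' _ _ (by simp)]
    refine lintegral_mono fun x => ?_
    have hmx : Measurable fun y => g x ^ 2 * k x y := hm.comp measurable_prodMk_left
    rw [← lintegral_add_left hmx, ← lintegral_const_mul' _ _ (by simp)]
    refine lintegral_mono fun y => ?_
    rw [← add_mul, ← mul_assoc]
    exact mul_le_mul_left (ENNReal.two_mul_mul_le_sq_add_sq _ _) _
  rw [h2, ← two_mul] at h3
  exact ((ENNReal.mul_le_mul_iff_right (by simp) (by simp)).1 h3).trans h1

theorem integrable_of_measurable_of_bound {α : Type*} [MeasurableSpace α] {μ : Measure α}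
    [IsFiniteMeasure μ] {f : α → ℂ} (hf : Measurable f) {M : ℝ} (hM : ∀ x, ‖f x‖ ≤ M) :
    Integrable f μ :=
  Integrable.of_bound hf.aestronglyMeasurable M (Filter.Eventually.of_forall hM)

/-- The `T T^*` inequality for the operator with kernel `a` applied to the function `1`. -/
theorem lintegral_enorm_integral_sq_le {α γ : Type*} [MeasurableSpace α] [MeasurableSpace γ]
    {μ : Measure α} {ν : Measure γ} [IsFiniteMeasure μ] [IsFiniteMeasure ν] {a : α → γ → ℂ}
    (ha : Measurable (Function.uncurry a)) {M : ℝ} (hM : ∀ x z, ‖a x z‖ ≤ M) :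
    ∫⁻ x, ‖∫ z, a x z ∂ν‖ₑ ^ 2 ∂μ ≤
      ∫⁻ z, ∫⁻ z', ‖∫ x, a x z * starRingEnd ℂ (a x z') ∂μ‖ₑ ∂ν ∂ν := by
  set T : α → ℂ := fun x => ∫ z, a x z ∂ν with hT
  have hTm : Measurable T := (ha.stronglyMeasurable.integral_prod_right).measurable
  have hTb : ∀ x, ‖T x‖ ≤ M * ν.real Set.univ := fun x =>
    norm_integral_le_of_norm_le_const (Filter.Eventually.of_forall (hM x))
  have hM0 : ∀ x z z', ‖a x z * starRingEnd ℂ (a x z')‖ ≤ M * M := fun x z z' => by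
    rw [norm_mul, RCLike.norm_conj]
    exact mul_le_mul (hM _ _) (hM _ _) (norm_nonneg _) ((norm_nonneg _).trans (hM x z))
  have hmeas : Measurable fun q : α × (γ × γ) => a q.1 q.2.1 * starRingEnd ℂ (a q.1 q.2.2) := by
    have h1 : Measurable fun q : α × (γ × γ) => a q.1 q.2.1 :=
      ha.comp (measurable_fst.prodMk (measurable_fst.comp measurable_snd))
    have h2 : Measurable fun q : α × (γ × γ) => a q.1 q.2.2 :=
      ha.comp (measurable_fst.prodMk (measurable_snd.comp measurable_snd))
    exact h1.mul (Complex.continuous_conj.measurable.comp h2)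
  -- The square is rewritten as the norm of a complex integral, so that Fubini can bring the
  -- x-integral inside before absolute values are taken.
  have h1 : ∫⁻ x, ‖T x‖ₑ ^ 2 ∂μ = ‖∫ x, T x * starRingEnd ℂ (T x) ∂μ‖ₑ := by
    have e1 : ∀ x, T x * starRingEnd ℂ (T x) = ((‖T x‖ ^ 2 : ℝ) : ℂ) := fun x => by
      rw [Complex.mul_conj, Complex.normSq_eq_norm_sq]
    simp only [e1]
    rw [integral_complex_ofReal]
    have e2 : Integrable (fun x => ‖T x‖ ^ 2) μ := by
      refine Integrable.of_bound (hTm.norm.pow_const 2).aestronglyMeasurable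
        ((M * ν.real Set.univ) ^ 2) (Filter.Eventually.of_forall fun x => ?_)
      rw [Real.norm_of_nonneg (by positivity)]
      exact pow_le_pow_left₀ (norm_nonneg _) (hTb x) 2
    rw [← ofReal_norm, Complex.norm_real, Real.norm_eq_abs,
      abs_of_nonneg (integral_nonneg fun x => by positivity),
      ofReal_integral_eq_lintegral_ofReal e2 (Filter.Eventually.of_forall fun x => by positivity)]
    refine lintegral_congr fun x => ?_
    rw [ENNReal.ofReal_pow (norm_nonneg _), ofReal_norm]
  rw [h1]
  have h2 : ∫ x, T x * starRingEnd ℂ (T x) ∂μ =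
      ∫ q : γ × γ, ∫ x, a x q.1 * starRingEnd ℂ (a x q.2) ∂μ ∂(ν.prod ν) := by
    rw [integral_integral_swap]
    · refine integral_congr_ae (Filter.Eventually.of_forall fun x => ?_)
      simp only [hT]
      rw [← integral_conj, ← integral_prod_mul]
    · refine integrable_of_measurable_of_bound (M := M * M) ?_ fun q => hM0 _ _ _
      exact hmeas.comp measurable_swap
  rw [h2]
  refine (enorm_integral_le_lintegral_enorm _).trans (le_of_eq ?_)
  rw [lintegral_prod]
  refine Measurable.aemeasurable ?_
  refine Measurable.enorm ?_
  exact ((hmeas.comp measurable_swap).stronglyMeasurable.integral_prod_right'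
    (f := fun q : (γ × γ) × α => a q.2 q.1.1 * starRingEnd ℂ (a q.2 q.1.2))).measurable

theorem enorm_mul_conj_sq (u v : ℂ) :
    ‖u * starRingEnd ℂ v‖ₑ ^ 2 = ‖u‖ₑ ^ 2 * ‖v‖ₑ ^ 2 := by
  rw [enorm_mul, RCLike.enorm_conj, mul_pow]

/-- For fixed y this is Schur's test for κ applied to z ↦ |F(y,z)|²; the L⁴ norm appears because
this function is measured in L². -/
theorem lintegral_lintegral_mul_lintegral_le {β γ : Type*} [MeasurableSpace β]
    [MeasurableSpace γ] {ν : Measure β} {ρ : Measure γ} [IsFiniteMeasure ν] [IsFiniteMeasure ρ]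
    {F : β × γ → ℂ} (hF : Measurable F) {κ : γ → γ → ℝ≥0∞} {E : ℝ≥0∞}
    (hκ : Measurable (Function.uncurry κ)) (hκsymm : ∀ z z', κ z z' = κ z' z)
    (hκE : ∀ z, ∫⁻ z', κ z z' ∂ρ ≤ E) :
    ∫⁻ z, ∫⁻ z', κ z z' * ∫⁻ y, ‖F (y, z)‖ₑ ^ 2 * ‖F (y, z')‖ₑ ^ 2 ∂ν ∂ρ ∂ρ ≤
      E * ∫⁻ p, ‖F p‖ₑ ^ 4 ∂(ν.prod ρ) := by
  have hm : Measurable fun q : (γ × γ) × β =>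
      κ q.1.1 q.1.2 * (‖F (q.2, q.1.1)‖ₑ ^ 2 * ‖F (q.2, q.1.2)‖ₑ ^ 2) := by
    refine (hκ.comp measurable_fst).mul
      (((hF.comp ?_).enorm.pow_const 2).mul ((hF.comp ?_).enorm.pow_const 2))
    · exact measurable_snd.prodMk (measurable_fst.comp measurable_fst)
    · exact measurable_snd.prodMk (measurable_snd.comp measurable_fst)
  have h1 : ∀ z z', κ z z' * ∫⁻ y, ‖F (y, z)‖ₑ ^ 2 * ‖F (y, z')‖ₑ ^ 2 ∂ν =
      ∫⁻ y, κ z z' * (‖F (y, z)‖ₑ ^ 2 * ‖F (y, z')‖ₑ ^ 2) ∂ν := fun z z' => by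
    rw [lintegral_const_mul]
    exact ((hF.comp (measurable_id.prodMk measurable_const)).enorm.pow_const 2).mul
      ((hF.comp (measurable_id.prodMk measurable_const)).enorm.pow_const 2)
  simp only [h1]
  rw [← lintegral_prod (fun q : γ × γ => ∫⁻ y, κ q.1 q.2 *
    (‖F (y, q.1)‖ₑ ^ 2 * ‖F (y, q.2)‖ₑ ^ 2) ∂ν) hm.lintegral_prod_right'.aemeasurable,
    lintegral_lintegral_swap hm.aemeasurable, lintegral_prod _ (hF.enorm.pow_const 4).aemeasurable,
    ← lintegral_const_mul _ (hF.enorm.pow_const 4).lintegral_prod_right']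
  refine lintegral_mono fun y => ?_
  have hmy : Measurable fun q : γ × γ =>
      κ q.1 q.2 * (‖F (y, q.1)‖ₑ ^ 2 * ‖F (y, q.2)‖ₑ ^ 2) :=
    hm.comp (measurable_id.prodMk measurable_const)
  rw [lintegral_prod _ hmy.aemeasurable]
  have := lintegral_lintegral_mul_mul_le (μ := ρ) hκ hκsymm hκE
    (g := fun z => ‖F (y, z)‖ₑ ^ 2) ((hF.comp measurable_prodMk_left).enorm.pow_const 2)
  simp only [← pow_mul] at this
  refine le_trans (le_of_eq ?_) this
  refine lintegral_congr fun z => lintegral_congr fun z' => ?_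
  ring

/-- The trilinear estimate on a product of finite measure spaces, given bounds for the twice
iterated `T T^*` kernel. -/
theorem enorm_trilinear_le {α β γ : Type*} [MeasurableSpace α] [MeasurableSpace β]
    [MeasurableSpace γ] {μ : Measure α} {ν : Measure β} {ρ : Measure γ} [IsFiniteMeasure μ]
    [IsFiniteMeasure ν] [IsFiniteMeasure ρ] {K : α × β → γ → ℂ} {F : β × γ → ℂ} {G : α × γ → ℂ}
    {H : α × β → ℂ} {M : ℝ} (hK : Measurable (Function.uncurry K)) (hF : Measurable F)
    (hG : Measurable G) (hH : Measurable H) (hKM : ∀ p z, ‖K p z‖ ≤ M) (hFM : ∀ p, ‖F p‖ ≤ M)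
    (hGM : ∀ p, ‖G p‖ ≤ M) {k : γ → γ → α → α → ℝ≥0∞} {κ : γ → γ → ℝ≥0∞} {E : ℝ≥0∞}
    (hk : ∀ z z', Measurable (Function.uncurry (k z z')))
    (hksymm : ∀ z z' x x', k z z' x x' = k z z' x' x)
    (hκ : Measurable (Function.uncurry κ)) (hκsymm : ∀ z z', κ z z' = κ z' z)
    (hKk : ∀ᵐ z ∂ρ, ∀ᵐ z' ∂ρ, ∀ᵐ x ∂μ, ∀ᵐ x' ∂μ, ‖∫ y, K (x, y) z * starRingEnd ℂ (K (x, y) z') *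
      starRingEnd ℂ (K (x', y) z * starRingEnd ℂ (K (x', y) z')) ∂ν‖ₑ ≤ k z z' x x')
    (hkκ : ∀ z z' x, ∫⁻ x', k z z' x x' ∂μ ≤ κ z z' ^ 2)
    (hκE : ∀ z, ∫⁻ z', κ z z' ∂ρ ≤ E) :
    ‖∫ p, (∫ z, K p z * F (p.2, z) * G (p.1, z) ∂ρ) * H p ∂(μ.prod ν)‖ₑ ^ 4 ≤
      E ^ 2 * (∫⁻ p, ‖H p‖ₑ ^ 2 ∂(μ.prod ν)) ^ 2 * (∫⁻ p, ‖F p‖ₑ ^ 4 ∂(ν.prod ρ)) *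
        ∫⁻ p, ‖G p‖ₑ ^ 4 ∂(μ.prod ρ) := by
  set a : α × β → γ → ℂ := fun p z => K p z * F (p.2, z) * G (p.1, z) with ha
  have ham : Measurable (Function.uncurry a) := by
    refine (hK.mul (hF.comp ?_)).mul (hG.comp ?_)
    · exact (measurable_snd.comp measurable_fst).prodMk measurable_snd
    · exact (measurable_fst.comp measurable_fst).prodMk measurable_snd
  have haM : ∀ p z, ‖a p z‖ ≤ M * M * M := fun p z => by
    have hM : 0 ≤ M := (norm_nonneg _).trans (hKM p z)
    rw [ha]; simp only [norm_mul]
    exact mul_le_mul (mul_le_mul (hKM _ _) (hFM _) (norm_nonneg _) hM) (hGM _) (norm_nonneg _)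
      (mul_nonneg hM hM)
  have haT : Measurable fun p => ∫ z, a p z ∂ρ :=
    (ham.stronglyMeasurable.integral_prod_right).measurable
  set X := ∫⁻ p, ‖∫ z, a p z ∂ρ‖ₑ ^ 2 ∂(μ.prod ν) with hX
  -- First use of Cauchy-Schwarz: H leaves in L².
  have step1 : ‖∫ p, (∫ z, a p z ∂ρ) * H p ∂(μ.prod ν)‖ₑ ^ 2 ≤
      (∫⁻ p, ‖H p‖ₑ ^ 2 ∂(μ.prod ν)) * X := by
    refine (pow_le_pow_left' (enorm_integral_le_lintegral_enorm _) 2).trans ?_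
    refine lintegral_sq_le_of_sq_le_mul (hH.enorm.pow_const 2).aemeasurable
      (haT.enorm.pow_const 2).aemeasurable (Filter.Eventually.of_forall fun p => ?_)
    rw [enorm_mul, mul_pow, mul_comm]
  set Φ : γ → γ → ℝ≥0∞ := fun z z' => ∫⁻ y, ‖F (y, z)‖ₑ ^ 2 * ‖F (y, z')‖ₑ ^ 2 ∂ν with hΦ
  set Γ : γ → γ → ℝ≥0∞ := fun z z' => ∫⁻ x, ‖G (x, z)‖ₑ ^ 2 * ‖G (x, z')‖ₑ ^ 2 ∂μ with hΓ
  set W : γ → γ → ℝ≥0∞ :=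
    fun z z' => ‖∫ p, a p z * starRingEnd ℂ (a p z') ∂(μ.prod ν)‖ₑ with hW
  have step2 : X ≤ ∫⁻ z, ∫⁻ z', W z z' ∂ρ ∂ρ := lintegral_enorm_integral_sq_le ham haM
  have step3 : ∀ᵐ z ∂ρ, ∀ᵐ z' ∂ρ, W z z' ^ 2 ≤ (κ z z' * Φ z z') * (κ z z' * Γ z z') := by
    filter_upwards [hKk] with z hz
    filter_upwards [hz] with z' hzz'
    set c : β → α → ℂ := fun y x =>
      K (x, y) z * starRingEnd ℂ (K (x, y) z') * (G (x, z) * starRingEnd ℂ (G (x, z'))) with hc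
    have hKz : ∀ z, Measurable fun q : β × α => K (q.2, q.1) z := fun z =>
      hK.comp (measurable_swap.prodMk measurable_const)
    have hGz : ∀ z, Measurable fun x => G (x, z) := fun z =>
      hG.comp (measurable_id.prodMk measurable_const)
    have hFz : ∀ z, Measurable fun y => F (y, z) := fun z =>
      hF.comp (measurable_id.prodMk measurable_const)
    have hconj := Complex.continuous_conj.measurable
    have hcm : Measurable (Function.uncurry c) :=
      ((hKz z).mul (hconj.comp (hKz z'))).mul
        (((hGz z).comp measurable_snd).mul (hconj.comp ((hGz z').comp measurable_snd)))
    have hcM : ∀ y x, ‖c y x‖ ≤ M * M * (M * M) := fun y x => by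
      have hM : 0 ≤ M := (norm_nonneg _).trans (hKM (x, y) z)
      rw [hc]; simp only [norm_mul, RCLike.norm_conj]
      exact mul_le_mul (mul_le_mul (hKM _ _) (hKM _ _) (norm_nonneg _) hM)
        (mul_le_mul (hGM _) (hGM _) (norm_nonneg _) hM) (by positivity) (by positivity)
    have hcT : Measurable fun y => ∫ x, c y x ∂μ :=
      (hcm.stronglyMeasurable.integral_prod_right).measurable
    -- The factor with F does not depend on x, so it comes out of the inner integral and
    -- Cauchy-Schwarz in y can remove it.
    have e1 : ∫ p, a p z * starRingEnd ℂ (a p z') ∂(μ.prod ν) =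
        ∫ y, F (y, z) * starRingEnd ℂ (F (y, z')) * ∫ x, c y x ∂μ ∂ν := by
      rw [integral_prod_symm]
      · refine integral_congr_ae (Filter.Eventually.of_forall fun y => ?_)
        simp only
        rw [← integral_const_mul]
        refine integral_congr_ae (Filter.Eventually.of_forall fun x => ?_)
        simp only [ha, hc, map_mul]
        ring
      · have hz : ∀ z, Measurable fun p => a p z := fun z =>
          ham.comp (measurable_id.prodMk measurable_const)
        refine integrable_of_measurable_of_bound ((hz z).mul (hconj.comp (hz z')))
          (M := M * M * M * (M * M * M)) fun p => ?_
        simp only [norm_mul, RCLike.norm_conj]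
        exact mul_le_mul (haM _ _) (haM _ _) (norm_nonneg _) ((norm_nonneg _).trans (haM p z))
    have e2 : W z z' ^ 2 ≤ Φ z z' * ∫⁻ y, ‖∫ x, c y x ∂μ‖ₑ ^ 2 ∂ν := by
      simp only [hW]
      rw [e1]
      refine (pow_le_pow_left' (enorm_integral_le_lintegral_enorm _) 2).trans ?_
      refine lintegral_sq_le_of_sq_le_mul
        (((hFz z).enorm.pow_const 2).mul ((hFz z').enorm.pow_const 2)).aemeasurable
        (hcT.enorm.pow_const 2).aemeasurable (Filter.Eventually.of_forall fun p => ?_)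
      rw [enorm_mul, mul_pow, enorm_mul_conj_sq]
    -- Second T T* step, now in x; Schur's test with row bound κ² follows.
    have e3 : ∫⁻ y, ‖∫ x, c y x ∂μ‖ₑ ^ 2 ∂ν ≤ κ z z' ^ 2 * Γ z z' := by
      refine (lintegral_enorm_integral_sq_le hcm hcM).trans ?_
      have hg : Measurable fun x => ‖G (x, z) * starRingEnd ℂ (G (x, z'))‖ₑ :=
        ((hGz z).mul (hconj.comp (hGz z'))).enorm
      have := lintegral_lintegral_mul_mul_le (hk z z') (hksymm z z') (hkκ z z') hg
      simp only [enorm_mul_conj_sq] at this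
      refine le_trans ?_ this
      refine lintegral_mono_ae ?_
      filter_upwards [hzz'] with x hx
      refine lintegral_mono_ae ?_
      filter_upwards [hx] with x' hx'
      have e4 : ∫ y, c y x * starRingEnd ℂ (c y x') ∂ν =
          (G (x, z) * starRingEnd ℂ (G (x, z'))) *
            starRingEnd ℂ (G (x', z) * starRingEnd ℂ (G (x', z'))) *
          ∫ y, K (x, y) z * starRingEnd ℂ (K (x, y) z') *
            starRingEnd ℂ (K (x', y) z * starRingEnd ℂ (K (x', y) z')) ∂ν := by
        rw [← integral_const_mul]
        refine integral_congr_ae (Filter.Eventually.of_forall fun y => ?_)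
        simp only [hc, map_mul]
        ring
      rw [e4, enorm_mul, enorm_mul, RCLike.enorm_conj]
      exact mul_le_mul_right hx' _
    calc W z z' ^ 2 ≤ Φ z z' * (κ z z' ^ 2 * Γ z z') := e2.trans (mul_le_mul_right e3 _)
      _ = _ := by ring
  have hΦm : Measurable fun q : γ × γ => κ q.1 q.2 * Φ q.1 q.2 := by
    refine hκ.mul (Measurable.lintegral_prod_right' (f := fun q : (γ × γ) × β =>
      ‖F (q.2, q.1.1)‖ₑ ^ 2 * ‖F (q.2, q.1.2)‖ₑ ^ 2) ?_)
    refine ((hF.comp ?_).enorm.pow_const 2).mul ((hF.comp ?_).enorm.pow_const 2)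
    · exact measurable_snd.prodMk (measurable_fst.comp measurable_fst)
    · exact measurable_snd.prodMk (measurable_snd.comp measurable_fst)
  have hΓm : Measurable fun q : γ × γ => κ q.1 q.2 * Γ q.1 q.2 := by
    refine hκ.mul (Measurable.lintegral_prod_right' (f := fun q : (γ × γ) × α =>
      ‖G (q.2, q.1.1)‖ₑ ^ 2 * ‖G (q.2, q.1.2)‖ₑ ^ 2) ?_)
    refine ((hG.comp ?_).enorm.pow_const 2).mul ((hG.comp ?_).enorm.pow_const 2)
    · exact measurable_snd.prodMk (measurable_fst.comp measurable_fst)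
    · exact measurable_snd.prodMk (measurable_snd.comp measurable_fst)
  -- κ² is shared evenly between F and G, so that each gets one factor κ for Schur's test in z.
  have step4 : X ^ 2 ≤ (∫⁻ z, ∫⁻ z', κ z z' * Φ z z' ∂ρ ∂ρ) *
      ∫⁻ z, ∫⁻ z', κ z z' * Γ z z' ∂ρ ∂ρ := by
    refine (pow_le_pow_left' step2 2).trans ?_
    refine lintegral_sq_le_of_sq_le_mul hΦm.lintegral_prod_right'.aemeasurable
      hΓm.lintegral_prod_right'.aemeasurable ?_
    filter_upwards [step3] with z hz
    exact lintegral_sq_le_of_sq_le_mul (hΦm.comp measurable_prodMk_left).aemeasurable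
      (hΓm.comp measurable_prodMk_left).aemeasurable hz
  have step5 := step4.trans (mul_le_mul'
    (lintegral_lintegral_mul_lintegral_le (ν := ν) hF hκ hκsymm hκE)
    (lintegral_lintegral_mul_lintegral_le (ν := μ) hG hκ hκsymm hκE))
  calc _ = (‖∫ p, (∫ z, a p z ∂ρ) * H p ∂(μ.prod ν)‖ₑ ^ 2) ^ 2 := by rw [← pow_mul]
    _ ≤ ((∫⁻ p, ‖H p‖ₑ ^ 2 ∂(μ.prod ν)) * X) ^ 2 := pow_le_pow_left' step1 2
    _ = (∫⁻ p, ‖H p‖ₑ ^ 2 ∂(μ.prod ν)) ^ 2 * X ^ 2 := mul_pow _ _ _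
    _ ≤ _ := mul_le_mul_right step5 _
    _ = _ := by ring

/-! ### Decomposition into cells -/

theorem Finset.sum_sq_le_of_sq_le_mul_ennreal {ι : Type*} (s : Finset ι) {w f g : ι → ℝ≥0∞}
    (h : ∀ i ∈ s, w i ^ 2 ≤ f i * g i) :
    (∑ i ∈ s, w i) ^ 2 ≤ (∑ i ∈ s, f i) * ∑ i ∈ s, g i := by
  classical
  let _ : MeasurableSpace s := ⊤
  have := lintegral_sq_le_of_sq_le_mul (μ := Measure.count) (w := fun i : s => w i)
    (f := fun i : s => f i) (g := fun i : s => g i) (measurable_of_finite _).aemeasurable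
    (measurable_of_finite _).aemeasurable (Filter.Eventually.of_forall fun i => h i i.2)
  simpa only [lintegral_count, tsum_fintype, Finset.sum_coe_sort] using this

/-- Two applications of Cauchy-Schwarz. Since h depends only on i and f only on j, summing over the
other index costs one cardinality each. The one from h is then squared twice over the fourth power
and the one from f is not, which gives exponent 2 + 1 = 3. -/
theorem sum_sum_pow_four_le {ι : Type*} (s : Finset ι) {w g : ι → ι → ℝ≥0∞} {h f : ι → ℝ≥0∞}
    {E : ℝ≥0∞} (hw : ∀ i ∈ s, ∀ j ∈ s, w i j ^ 4 ≤ E ^ 2 * h i ^ 2 * f j * g i j) :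
    (∑ i ∈ s, ∑ j ∈ s, w i j) ^ 4 ≤
      E ^ 2 * s.card ^ 3 * (∑ i ∈ s, h i) ^ 2 * (∑ j ∈ s, f j) * ∑ i ∈ s, ∑ j ∈ s, g i j := by
  have hr : ∀ y : ℝ≥0∞, (y ^ (1 / 2 : ℝ)) ^ (2 : ℕ) = y := fun y => by
    rw [← ENNReal.rpow_natCast, ← ENNReal.rpow_mul]; norm_num
  set d : ι × ι → ℝ≥0∞ := fun p => (f p.2 * g p.1 p.2) ^ (1 / 2 : ℝ)
  simp only [← Finset.sum_product']
  have h1 : (∑ p ∈ s ×ˢ s, w p.1 p.2) ^ 2 ≤ (∑ p ∈ s ×ˢ s, E * h p.1) * ∑ p ∈ s ×ˢ s, d p := by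
    refine Finset.sum_sq_le_of_sq_le_mul_ennreal _ fun p hp => ?_
    rw [Finset.mem_product] at hp
    refine (ENNReal.pow_le_pow_left_iff (n := 2) two_ne_zero).1 ?_
    rw [mul_pow, hr, ← pow_mul]
    refine (hw _ hp.1 _ hp.2).trans (le_of_eq ?_)
    ring
  have h2 : (∑ p ∈ s ×ˢ s, d p) ^ 2 ≤ (∑ p ∈ s ×ˢ s, f p.2) * ∑ p ∈ s ×ˢ s, g p.1 p.2 :=
    Finset.sum_sq_le_of_sq_le_mul_ennreal _ fun p _ => (hr _).le
  have h3 : ∑ p ∈ s ×ˢ s, E * h p.1 = E * (s.card * ∑ i ∈ s, h i) := by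
    rw [← Finset.mul_sum, Finset.sum_product]
    simp [Finset.mul_sum]
  have h4 : ∑ p ∈ s ×ˢ s, f p.2 = s.card * ∑ i ∈ s, f i := by
    rw [Finset.sum_product]
    simp
  rw [h3] at h1
  rw [h4] at h2
  calc (∑ p ∈ s ×ˢ s, w p.1 p.2) ^ 4 = ((∑ p ∈ s ×ˢ s, w p.1 p.2) ^ 2) ^ 2 := by rw [← pow_mul]
    _ ≤ ((E * (s.card * ∑ i ∈ s, h i)) * ∑ p ∈ s ×ˢ s, d p) ^ 2 := pow_le_pow_left' h1 2
    _ = (E * (s.card * ∑ i ∈ s, h i)) ^ 2 * (∑ p ∈ s ×ˢ s, d p) ^ 2 := mul_pow _ _ _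
    _ ≤ _ := mul_le_mul_right h2 _
    _ = _ := by ring

theorem MeasureTheory.Measure.finsetSum_prod {ι α β : Type*} [MeasurableSpace α]
    [MeasurableSpace β] (s : Finset ι) (μ : ι → Measure α) [∀ i, IsFiniteMeasure (μ i)]
    (ν : Measure β) [IsFiniteMeasure ν] :
    (∑ i ∈ s, μ i).prod ν = ∑ i ∈ s, (μ i).prod ν := by
  classical
  induction s using Finset.induction_on with
  | empty => simp
  | insert i s hi ih =>
    rw [Finset.sum_insert hi, Finset.sum_insert hi, Measure.add_prod, ih]

theorem MeasureTheory.Measure.prod_finsetSum {ι α β : Type*} [MeasurableSpace α]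
    [MeasurableSpace β] (s : Finset ι) (μ : ι → Measure α) [∀ i, IsFiniteMeasure (μ i)]
    (ν : Measure β) [IsFiniteMeasure ν] :
    ν.prod (∑ i ∈ s, μ i) = ∑ i ∈ s, ν.prod (μ i) := by
  classical
  induction s using Finset.induction_on with
  | empty => simp
  | insert i s hi ih =>
    rw [Finset.sum_insert hi, Finset.sum_insert hi, Measure.prod_add, ih]

/-- Half-open intervals make the cells disjoint, so the measures add exactly. -/
theorem volume_restrict_Ioc_eq_sum (a w : ℝ) (hw : 0 ≤ w) (N : ℕ) :
    (volume : Measure ℝ).restrict (Set.Ioc a (a + N * w)) =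
      ∑ i ∈ Finset.range N, volume.restrict (Set.Ioc (a + i * w) (a + i * w + w)) := by
  induction N with
  | zero => simp
  | succ n ih =>
    rw [Finset.sum_range_succ, ← ih, ← Measure.restrict_union _ measurableSet_Ioc,
      Set.Ioc_union_Ioc_eq_Ioc]
    · push_cast; ring_nf
    · nlinarith [n.cast_nonneg (α := ℝ)]
    · nlinarith
    · exact Set.Ioc_disjoint_Ioc_of_le le_rfl

/-- The trilinear form with kernel `K`. -/
noncomputable def trilinearForm {α β γ : Type*} [MeasurableSpace α] [MeasurableSpace β]
    [MeasurableSpace γ] (μ : Measure α) (ν : Measure β) (ρ : Measure γ) (K : α × β → γ → ℂ)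
    (F : β × γ → ℂ) (G : α × γ → ℂ) (H : α × β → ℂ) : ℂ :=
  ∫ p, (∫ z, K p z * F (p.2, z) * G (p.1, z) ∂ρ) * H p ∂(μ.prod ν)

theorem norm_mul_mul_le_of_norm_le {u v w : ℂ} {M R : ℝ} (hu : ‖u‖ ≤ M) (hv : ‖v‖ ≤ R)
    (hw : ‖w‖ ≤ R) :
    ‖u * v * w‖ ≤ M * R * R := by
  have hM : 0 ≤ M := (norm_nonneg _).trans hu
  have hR : 0 ≤ R := (norm_nonneg _).trans hv
  simp only [norm_mul]
  exact mul_le_mul (mul_le_mul hu hv (norm_nonneg _) hM) hw (norm_nonneg _) (mul_nonneg hM hR)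

theorem norm_trilinear_outer_le {α β γ : Type*} [MeasurableSpace γ] {ρ : Measure γ} [IsFiniteMeasure ρ]
    {K : α × β → γ → ℂ} {F : β × γ → ℂ} {G : α × γ → ℂ} {H : α × β → ℂ} {M R : ℝ}
    (hKM : ∀ p z, ‖K p z‖ ≤ M) (hFM : ∀ p, ‖F p‖ ≤ R)
    (hGM : ∀ p, ‖G p‖ ≤ R) (hHM : ∀ p, ‖H p‖ ≤ R) (p : α × β) :
    ‖(∫ z, K p z * F (p.2, z) * G (p.1, z) ∂ρ) * H p‖ ≤ M * R * R * ρ.real Set.univ * R := by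
  have h : ‖∫ z, K p z * F (p.2, z) * G (p.1, z) ∂ρ‖ ≤ M * R * R * ρ.real Set.univ :=
    norm_integral_le_of_norm_le_const (Filter.Eventually.of_forall fun z =>
      norm_mul_mul_le_of_norm_le (hKM p z) (hFM _) (hGM _))
  rw [norm_mul]
  exact mul_le_mul h (hHM p) (norm_nonneg _) ((norm_nonneg _).trans h)

section trilinearForm

variable {α β γ : Type*} [MeasurableSpace α] [MeasurableSpace β] [MeasurableSpace γ]
  {μ : Measure α} {ν : Measure β} {ρ : Measure γ} [IsFiniteMeasure μ] [IsFiniteMeasure ν]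
  [IsFiniteMeasure ρ] {K K' : α × β → γ → ℂ} {F : β × γ → ℂ} {G : α × γ → ℂ}
  {H : α × β → ℂ} {M R : ℝ}

theorem measurable_trilinear_inner (hK : Measurable (Function.uncurry K)) (hF : Measurable F)
    (hG : Measurable G) :
    Measurable (Function.uncurry fun (p : α × β) (z : γ) => K p z * F (p.2, z) * G (p.1, z)) := by
  refine (hK.mul (hF.comp ?_)).mul (hG.comp ?_)
  · exact (measurable_snd.comp measurable_fst).prodMk measurable_snd
  · exact (measurable_fst.comp measurable_fst).prodMk measurable_snd

theorem integrable_trilinear_inner (hK : Measurable (Function.uncurry K)) (hF : Measurable F)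
    (hG : Measurable G) (hKM : ∀ p z, ‖K p z‖ ≤ M) (hFM : ∀ p, ‖F p‖ ≤ R)
    (hGM : ∀ p, ‖G p‖ ≤ R) (p : α × β) :
    Integrable (fun z => K p z * F (p.2, z) * G (p.1, z)) ρ :=
  integrable_of_measurable_of_bound
    ((measurable_trilinear_inner hK hF hG).comp measurable_prodMk_left)
    fun z => norm_mul_mul_le_of_norm_le (hKM p z) (hFM _) (hGM _)

theorem integrable_trilinear_outer (hK : Measurable (Function.uncurry K)) (hF : Measurable F)
    (hG : Measurable G) (hH : Measurable H) (hKM : ∀ p z, ‖K p z‖ ≤ M) (hFM : ∀ p, ‖F p‖ ≤ R)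
    (hGM : ∀ p, ‖G p‖ ≤ R) (hHM : ∀ p, ‖H p‖ ≤ R) :
    Integrable (fun p => (∫ z, K p z * F (p.2, z) * G (p.1, z) ∂ρ) * H p) (μ.prod ν) :=
  integrable_of_measurable_of_bound
    (((measurable_trilinear_inner hK hF hG).stronglyMeasurable.integral_prod_right).measurable.mul
      hH) fun p => norm_trilinear_outer_le hKM hFM hGM hHM p

/-- A qualitative bound, linear in the size M of the kernel. It makes the remainder of the level
decomposition vanish in the limit. -/
theorem norm_trilinearForm_le (hKM : ∀ p z, ‖K p z‖ ≤ M) (hFM : ∀ p, ‖F p‖ ≤ R)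
    (hGM : ∀ p, ‖G p‖ ≤ R) (hHM : ∀ p, ‖H p‖ ≤ R) :
    ‖trilinearForm μ ν ρ K F G H‖ ≤
      M * (R * R * ρ.real Set.univ * R * (μ.prod ν).real Set.univ) := by
  refine (norm_integral_le_of_norm_le_const (Filter.Eventually.of_forall fun p =>
    norm_trilinear_outer_le hKM hFM hGM hHM p)).trans (le_of_eq ?_)
  ring

theorem trilinearForm_add (hK : Measurable (Function.uncurry K))
    (hK' : Measurable (Function.uncurry K')) (hF : Measurable F)
    (hG : Measurable G) (hH : Measurable H) (hKM : ∀ p z, ‖K p z‖ ≤ M)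
    (hKM' : ∀ p z, ‖K' p z‖ ≤ M) (hFM : ∀ p, ‖F p‖ ≤ R)
    (hGM : ∀ p, ‖G p‖ ≤ R) (hHM : ∀ p, ‖H p‖ ≤ R) :
    trilinearForm μ ν ρ (fun p z => K p z + K' p z) F G H =
      trilinearForm μ ν ρ K F G H + trilinearForm μ ν ρ K' F G H := by
  rw [trilinearForm, trilinearForm, trilinearForm,
    ← integral_add (integrable_trilinear_outer hK hF hG hH hKM hFM hGM hHM)
      (integrable_trilinear_outer hK' hF hG hH hKM' hFM hGM hHM)]
  refine integral_congr_ae (Filter.Eventually.of_forall fun p => ?_)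
  simp only
  rw [← add_mul, ← integral_add (integrable_trilinear_inner hK hF hG hKM hFM hGM p)
      (integrable_trilinear_inner hK' hF hG hKM' hFM hGM p)]
  simp only [add_mul]

end trilinearForm

/-- Summation of the estimates on `N × N` cells. -/
theorem enorm_trilinear_sum_le {ι α β γ : Type*} [MeasurableSpace α] [MeasurableSpace β]
    [MeasurableSpace γ] (s : Finset ι) {μ : ι → Measure α} {ν : Measure β} {ρ : ι → Measure γ}
    [∀ i, IsFiniteMeasure (μ i)] [IsFiniteMeasure ν] [∀ i, IsFiniteMeasure (ρ i)]
    {K : α × β → γ → ℂ} {F : β × γ → ℂ} {G : α × γ → ℂ}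
    {H : α × β → ℂ} {M : ℝ} (hK : Measurable (Function.uncurry K)) (hF : Measurable F)
    (hG : Measurable G) (hH : Measurable H) (hKM : ∀ p z, ‖K p z‖ ≤ M) (hFM : ∀ p, ‖F p‖ ≤ M)
    (hGM : ∀ p, ‖G p‖ ≤ M) (hHM : ∀ p, ‖H p‖ ≤ M) {E : ℝ≥0∞}
    (hE : ∀ i ∈ s, ∀ j ∈ s, ‖trilinearForm (μ i) ν (ρ j) K F G H‖ₑ ^ 4 ≤
      E ^ 2 * (∫⁻ p, ‖H p‖ₑ ^ 2 ∂((μ i).prod ν)) ^ 2 * (∫⁻ p, ‖F p‖ₑ ^ 4 ∂(ν.prod (ρ j))) *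
        ∫⁻ p, ‖G p‖ₑ ^ 4 ∂((μ i).prod (ρ j))) :
    ‖trilinearForm (∑ i ∈ s, μ i) ν (∑ j ∈ s, ρ j) K F G H‖ₑ ^ 4 ≤
      E ^ 2 * s.card ^ 3 * (∫⁻ p, ‖H p‖ₑ ^ 2 ∂((∑ i ∈ s, μ i).prod ν)) ^ 2 *
        (∫⁻ p, ‖F p‖ₑ ^ 4 ∂(ν.prod (∑ j ∈ s, ρ j))) *
        ∫⁻ p, ‖G p‖ₑ ^ 4 ∂((∑ i ∈ s, μ i).prod (∑ j ∈ s, ρ j)) := by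
  set a : α × β → γ → ℂ := fun p z => K p z * F (p.2, z) * G (p.1, z) with ha
  have hinner : ∀ j p, Integrable (a p) (ρ j) := fun j p =>
    integrable_trilinear_inner hK hF hG hKM hFM hGM p
  have hint : ∀ i j, Integrable (fun p => (∫ z, a p z ∂(ρ j)) * H p) ((μ i).prod ν) :=
    fun i j => integrable_trilinear_outer hK hF hG hH hKM hFM hGM hHM
  have hsum : trilinearForm (∑ i ∈ s, μ i) ν (∑ j ∈ s, ρ j) K F G H =
      ∑ i ∈ s, ∑ j ∈ s, trilinearForm (μ i) ν (ρ j) K F G H := by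
    simp only [trilinearForm]
    rw [Measure.finsetSum_prod]
    have h1 : ∀ p, (∫ z, a p z ∂(∑ j ∈ s, ρ j)) * H p = ∑ j ∈ s, (∫ z, a p z ∂(ρ j)) * H p :=
      fun p => by
      rw [integral_finsetSum_measure fun j _ => hinner j p, Finset.sum_mul]
    simp only [ha] at h1 hint
    simp only [h1]
    rw [integral_finsetSum_measure fun i _ => integrable_finsetSum _ fun j _ => hint i j]
    exact Finset.sum_congr rfl fun i _ => integral_finsetSum _ fun j _ => hint i j
  rw [hsum, Measure.finsetSum_prod, Measure.prod_finsetSum, Measure.finsetSum_prod]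
  simp only [Measure.prod_finsetSum, lintegral_finsetSum_measure]
  refine le_trans (pow_le_pow_left' ?_ 4) (sum_sum_pow_four_le s hE)
  refine (enorm_sum_le _ _).trans (Finset.sum_le_sum fun i _ => enorm_sum_le _ _)

/-! ### Level decomposition of the cutoff -/

/-- A smooth function vanishing on `s ≤ 1` and equal to `1` on `2 ≤ s`. -/
noncomputable def smoothStep (s : ℝ) : ℝ := Real.smoothTransition (s - 1)

theorem smoothStep_of_le_one {s : ℝ} (h : s ≤ 1) : smoothStep s = 0 :=
  Real.smoothTransition.zero_of_nonpos (by linarith)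

theorem smoothStep_of_two_le {s : ℝ} (h : 2 ≤ s) : smoothStep s = 1 :=
  Real.smoothTransition.one_of_one_le (by linarith)

theorem contDiff_smoothStep : ContDiff ℝ ∞ smoothStep :=
  Real.smoothTransition.contDiff.comp (contDiff_id.sub contDiff_const)

/-- The part of `z` where `‖z‖` is comparable to `1`. -/
noncomputable def levelCutoff (z : ℂ) : ℂ :=
  (smoothStep (4 * ‖z‖ ^ 2) - smoothStep (‖z‖ ^ 2)) • z

theorem contDiff_levelCutoff : ContDiff ℝ ∞ levelCutoff := by
  have h : ContDiff ℝ ∞ fun z : ℂ => ‖z‖ ^ 2 := contDiff_norm_sq ℝ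
  exact ((contDiff_smoothStep.comp (contDiff_const.mul h)).sub
    (contDiff_smoothStep.comp h)).smul contDiff_id

theorem levelCutoff_eq_zero_of_norm_le {z : ℂ} (h : ‖z‖ ≤ 1 / 2) : levelCutoff z = 0 := by
  have h1 : ‖z‖ ^ 2 ≤ 1 / 4 := by nlinarith [norm_nonneg z]
  rw [levelCutoff, smoothStep_of_le_one (by linarith), smoothStep_of_le_one (by linarith)]
  simp

theorem levelCutoff_eq_zero_of_le_norm {z : ℂ} (h : 2 ≤ ‖z‖) : levelCutoff z = 0 := by
  have h1 : 4 ≤ ‖z‖ ^ 2 := by nlinarith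
  rw [levelCutoff, smoothStep_of_two_le (by linarith), smoothStep_of_two_le (by linarith)]
  simp

theorem ContDiff.exists_bound_fderiv_fderiv {E F : Type*} [NormedAddCommGroup E]
    [NormedSpace ℝ E] [NormedAddCommGroup F] [NormedSpace ℝ F] {f : E → F}
    (h0 : ContDiff ℝ ∞ f) (hc : HasCompactSupport f) :
    ∃ M : ℝ, 0 < M ∧ ∀ z, ‖f z‖ ≤ M ∧ ‖fderiv ℝ f z‖ ≤ M ∧ ‖fderiv ℝ (fderiv ℝ f) z‖ ≤ M := by
  have h1 : ContDiff ℝ ∞ (fderiv ℝ f) := h0.fderiv_right (by simp)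
  have h2 : ContDiff ℝ ∞ (fderiv ℝ (fderiv ℝ f)) := h1.fderiv_right (by simp)
  have b0 : ∃ C, ∀ x, ‖f x‖ ≤ C := hc.exists_bound_of_continuous h0.continuous
  have b1 : ∃ C, ∀ x, ‖fderiv ℝ f x‖ ≤ C :=
    HasCompactSupport.exists_bound_of_continuous (f := fderiv ℝ f) (hc.fderiv ℝ) h1.continuous
  have b2 : ∃ C, ∀ x, ‖fderiv ℝ (fderiv ℝ f) x‖ ≤ C :=
    HasCompactSupport.exists_bound_of_continuous (f := fderiv ℝ (fderiv ℝ f))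
      (HasCompactSupport.fderiv (f := fderiv ℝ f) ℝ (hc.fderiv ℝ)) h2.continuous
  obtain ⟨M0, hM0⟩ := b0
  obtain ⟨M1, hM1⟩ := b1
  obtain ⟨M2, hM2⟩ := b2
  refine ⟨|M0| + |M1| + |M2| + 1, by positivity, fun z => ⟨(hM0 z).trans ?_, (hM1 z).trans ?_,
    (hM2 z).trans ?_⟩⟩
  · linarith [le_abs_self M0, abs_nonneg M1, abs_nonneg M2]
  · linarith [le_abs_self M1, abs_nonneg M0, abs_nonneg M2]
  · linarith [le_abs_self M2, abs_nonneg M1, abs_nonneg M0]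

theorem hasCompactSupport_levelCutoff : HasCompactSupport levelCutoff :=
  HasCompactSupport.intro (isCompact_closedBall (0 : ℂ) 2) fun z hz =>
    levelCutoff_eq_zero_of_le_norm (by
      rw [mem_closedBall_zero_iff, not_le] at hz; exact hz.le)

/-- The part of `z` where `‖z‖` is comparable to `h`. -/
noncomputable def levelPart (h : ℝ) (z : ℂ) : ℂ := h • levelCutoff (h⁻¹ • z)

/-- In this form consecutive dyadic levels telescope. -/
theorem levelPart_eq {h : ℝ} (hh : 0 < h) (z : ℂ) :
    levelPart h z = smoothStep (‖z‖ ^ 2 / (h / 2) ^ 2) • z - smoothStep (‖z‖ ^ 2 / h ^ 2) • z := by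
  have e1 : ‖h⁻¹ • z‖ ^ 2 = ‖z‖ ^ 2 / h ^ 2 := by
    rw [norm_smul, Real.norm_of_nonneg (by positivity)]; field_simp
  have e2 : 4 * (‖z‖ ^ 2 / h ^ 2) = ‖z‖ ^ 2 / (h / 2) ^ 2 := by field_simp; ring
  rw [levelPart, levelCutoff, e1, e2, ← sub_smul, smul_comm, smul_inv_smul₀ hh.ne']

theorem lt_norm_of_levelPart_ne_zero {h : ℝ} (hh : 0 < h) {z : ℂ} (hz : levelPart h z ≠ 0) :
    h / 2 < ‖z‖ := by
  by_contra hn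
  refine hz ?_
  rw [levelPart, levelCutoff_eq_zero_of_norm_le, smul_zero]
  rw [norm_smul, norm_inv, Real.norm_of_nonneg hh.le, inv_mul_le_iff₀ hh]
  linarith

/-- Chain rule: the composition has size of order Cδ while its first derivative keeps the size C/b =
Cδ/(δb), so its natural scale is δb. -/
theorem HasScaleBound.levelPart {u u₁ u₂ : ℝ → ℂ} {C b M δ : ℝ} (hC : 0 < C) (hb : 0 < b)
    (hδ : 0 < δ) (hδ' : δ ≤ 1) (hM : ∀ z, ‖levelCutoff z‖ ≤ M ∧
    ‖fderiv ℝ levelCutoff z‖ ≤ M ∧ ‖fderiv ℝ (fderiv ℝ levelCutoff) z‖ ≤ M)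
    (hu : HasScaleBound u C b u₁ u₂) :
    ∃ v₁ v₂, HasScaleBound (fun t => levelPart (C * δ) (u t)) (2 * M * (C * δ)) (δ * b) v₁ v₂ := by
  obtain ⟨h1, h2, h3, h4, h5⟩ := hu
  set h := C * δ with hh
  have hh0 : 0 < h := by positivity
  have hM0 : 0 ≤ M := (norm_nonneg _).trans (hM 0).1
  have hG := contDiff_levelCutoff
  have hG1 : ContDiff ℝ ∞ (fderiv ℝ levelCutoff) := hG.fderiv_right (by simp)
  have d1 : ∀ t, HasDerivAt (fun t => h⁻¹ • u t) (h⁻¹ • u₁ t) t := fun t =>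
    (h1 t).fun_const_smul _
  have d2 : ∀ t, HasDerivAt (fun t => levelCutoff (h⁻¹ • u t))
      (fderiv ℝ levelCutoff (h⁻¹ • u t) (h⁻¹ • u₁ t)) t := fun t =>
    (hG.differentiable (by simp) _).hasFDerivAt.comp_hasDerivAt t (d1 t)
  have d3 : ∀ t, HasDerivAt (fun t => fderiv ℝ levelCutoff (h⁻¹ • u t))
      (fderiv ℝ (fderiv ℝ levelCutoff) (h⁻¹ • u t) (h⁻¹ • u₁ t)) t := fun t =>
    (hG1.differentiable (by simp) _).hasFDerivAt.comp_hasDerivAt t (d1 t)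
  refine ⟨fun t => fderiv ℝ levelCutoff (h⁻¹ • u t) (u₁ t),
    fun t => fderiv ℝ (fderiv ℝ levelCutoff) (h⁻¹ • u t) (h⁻¹ • u₁ t) (u₁ t) +
      fderiv ℝ levelCutoff (h⁻¹ • u t) (u₂ t), fun t => ?_, fun t => ?_, fun t => ?_,
    fun t => ?_, fun t => ?_⟩
  · refine ((d2 t).fun_const_smul h).congr_deriv ?_
    rw [map_smul, smul_smul, mul_inv_cancel₀ hh0.ne', one_smul]
  · exact (d3 t).clm_apply (h2 t)
  · change ‖h • levelCutoff (h⁻¹ • u t)‖ ≤ _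
    rw [norm_smul, Real.norm_of_nonneg hh0.le]
    nlinarith [(hM (h⁻¹ • u t)).1, mul_nonneg hM0 hh0.le]
  · calc _ ≤ M * (C / b) := (ContinuousLinearMap.le_opNorm _ _).trans
          (mul_le_mul (hM _).2.1 (h4 t) (norm_nonneg _) hM0)
      _ ≤ 2 * (M * (C / b)) := by linarith [mul_nonneg hM0 (div_nonneg hC.le hb.le)]
      _ = _ := by rw [hh]; field_simp
  · have n1 : ‖fderiv ℝ (fderiv ℝ levelCutoff) (h⁻¹ • u t) (h⁻¹ • u₁ t) (u₁ t)‖ ≤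
        M * (h⁻¹ * (C / b)) * (C / b) := by
      refine (ContinuousLinearMap.le_opNorm _ _).trans
        (mul_le_mul ((ContinuousLinearMap.le_opNorm _ _).trans ?_) (h4 t) (norm_nonneg _)
        (by positivity))
      refine mul_le_mul (hM _).2.2 ?_ (norm_nonneg _) hM0
      rw [norm_smul, Real.norm_of_nonneg (by positivity)]
      exact mul_le_mul_of_nonneg_left (h4 t) (by positivity)
    have n2 : ‖fderiv ℝ levelCutoff (h⁻¹ • u t) (u₂ t)‖ ≤ M * (C / b ^ 2) :=
      (ContinuousLinearMap.le_opNorm _ _).trans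
        (mul_le_mul (hM _).2.1 (h5 t) (norm_nonneg _) hM0)
    calc _ ≤ M * (h⁻¹ * (C / b)) * (C / b) + M * (C / b ^ 2) :=
          (norm_add_le _ _).trans (add_le_add n1 n2)
      -- The term with the second derivative of the cutoff dominates; the other is smaller by the
      -- factor δ ≤ 1.
      _ = (1 + δ) * (M * C / (δ * b ^ 2)) := by rw [hh]; field_simp
      _ ≤ 2 * (M * C / (δ * b ^ 2)) := by
          apply mul_le_mul_of_nonneg_right _ (by positivity); linarith
      _ = _ := by rw [hh]; field_simp

/-! ### Coordinate derivatives and second differences -/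

theorem update_eq_add_smul {d : ℕ} (x : Fin d → ℝ) (j : Fin d) (s : ℝ) :
    Function.update x j s = x + (s - x j) • Pi.single j (1 : ℝ) := by
  ext i
  rcases eq_or_ne i j with rfl | h
  · simp
  · simp [h]

section coordDeriv

variable {d : ℕ} {F : Type*} [NormedAddCommGroup F] [NormedSpace ℝ F] {g g' : (Fin d → ℝ) → F}
  {Ω : Set (Fin d → ℝ)}

theorem hasDerivAt_update_of_differentiableAt {x : Fin d → ℝ} (hg : DifferentiableAt ℝ g x)
    (j : Fin d) : HasDerivAt (fun s => g (Function.update x j s)) (coordDeriv j g x) (x j) := by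
  have h1 : HasDerivAt (fun t : ℝ => g (x + t • Pi.single j (1 : ℝ))) (coordDeriv j g x)
      (x j - x j) := by
    rw [sub_self]
    exact hg.lineDifferentiableAt.hasLineDerivAt
  have h2 := h1.comp_sub_const (x j) (x j)
  refine h2.congr_of_eventuallyEq (Filter.Eventually.of_forall fun s => ?_)
  simp [update_eq_add_smul]

theorem coordDeriv_eq_fderiv (hΩ : IsOpen Ω) (hg : ContDiffOn ℝ ∞ g Ω) (j : Fin d) :
    Set.EqOn (coordDeriv j g) (fun x => fderiv ℝ g x (Pi.single j 1)) Ω := fun x hx =>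
  ((hg.contDiffAt (hΩ.mem_nhds hx)).differentiableAt (by simp)).lineDeriv_eq_fderiv

theorem ContDiffOn.coordDeriv (hΩ : IsOpen Ω) (hg : ContDiffOn ℝ ∞ g Ω) (j : Fin d) :
    ContDiffOn ℝ ∞ (coordDeriv j g) Ω :=
  ((hg.fderiv_of_isOpen hΩ (by simp)).clm_apply contDiffOn_const).congr
    (coordDeriv_eq_fderiv hΩ hg j)

theorem Set.EqOn.coordDeriv (hΩ : IsOpen Ω) (h : Set.EqOn g g' Ω) (j : Fin d) :
    Set.EqOn (coordDeriv j g) (coordDeriv j g') Ω := fun x hx => by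
  refine Filter.EventuallyEq.lineDeriv_eq ?_
  filter_upwards [hΩ.mem_nhds hx] with y hy using h hy

theorem coordDeriv_comm (hΩ : IsOpen Ω) (hg : ContDiffOn ℝ ∞ g Ω) (i j : Fin d) :
    Set.EqOn (coordDeriv i (coordDeriv j g)) (coordDeriv j (coordDeriv i g)) Ω := by
  have key : ∀ i j : Fin d, Set.EqOn (coordDeriv i (coordDeriv j g))
      (fun x => fderiv ℝ (fderiv ℝ g) x (Pi.single i 1) (Pi.single j 1)) Ω := fun i j x hx => by
    rw [(coordDeriv_eq_fderiv hΩ hg j).coordDeriv hΩ i hx]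
    have h1 : DifferentiableAt ℝ (fderiv ℝ g) x :=
      ((hg.fderiv_of_isOpen (m := ∞) hΩ (by simp)).contDiffAt (hΩ.mem_nhds hx)).differentiableAt
        (by simp)
    have h2 := h1.hasFDerivAt.clm_apply (hasFDerivAt_const (Pi.single j (1 : ℝ)) x)
    rw [_root_.coordDeriv, h2.differentiableAt.lineDeriv_eq_fderiv, h2.fderiv]
    simp
  intro x hx
  rw [key i j hx, key j i hx]
  have hs : IsSymmSndFDerivAt ℝ g x :=
    (hg.contDiffAt (hΩ.mem_nhds hx)).isSymmSndFDerivAt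
      (by simpa using (WithTop.coe_le_coe.2 le_top : ((2 : ℕ∞) : WithTop ℕ∞) ≤ (⊤ : ℕ∞)))
  exact hs.eq _ _

end coordDeriv

theorem exists_sub_eq_mul_deriv {f f' : ℝ → ℝ} {x x' : ℝ}
    (h : ∀ s ∈ Set.uIcc x x', HasDerivAt f (f' s) s) :
    ∃ s ∈ Set.uIcc x x', f x - f x' = (x - x') * f' s := by
  have key : ∀ a b : ℝ, a < b → (∀ s ∈ Set.Icc a b, HasDerivAt f (f' s) s) →
      ∃ s ∈ Set.Icc a b, f b - f a = (b - a) * f' s := fun a b hab h => by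
    obtain ⟨c, hc, hc'⟩ := exists_hasDerivAt_eq_slope f f' hab
      (fun s hs => (h s hs).continuousAt.continuousWithinAt)
      (fun s hs => h s (Set.Ioo_subset_Icc_self hs))
    refine ⟨c, Set.Ioo_subset_Icc_self hc, ?_⟩
    rw [hc']
    field_simp [sub_ne_zero.2 hab.ne']
  rcases lt_trichotomy x x' with hx | rfl | hx
  · rw [Set.uIcc_of_le hx.le] at h ⊢
    obtain ⟨s, hs, e⟩ := key _ _ hx h
    exact ⟨s, hs, by linarith⟩
  · exact ⟨x, by simp, by simp⟩
  · rw [Set.uIcc_of_ge hx.le] at h ⊢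
    exact key _ _ hx h

section threeVariables

variable {F : Type*} [NormedAddCommGroup F] [NormedSpace ℝ F] {g : (Fin 3 → ℝ) → F}
  {x y z : ℝ}

theorem hasDerivAt_vec_zero (hg : DifferentiableAt ℝ g ![x, y, z]) :
    HasDerivAt (fun s => g ![s, y, z]) (coordDeriv 0 g ![x, y, z]) x := by
  refine (hasDerivAt_update_of_differentiableAt hg 0).congr_of_eventuallyEq
    (Filter.Eventually.of_forall fun s => ?_)
  refine congrArg g ?_; ext i; fin_cases i <;> simp

theorem hasDerivAt_vec_one (hg : DifferentiableAt ℝ g ![x, y, z]) :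
    HasDerivAt (fun s => g ![x, s, z]) (coordDeriv 1 g ![x, y, z]) y := by
  refine (hasDerivAt_update_of_differentiableAt hg 1).congr_of_eventuallyEq
    (Filter.Eventually.of_forall fun s => ?_)
  refine congrArg g ?_; ext i; fin_cases i <;> simp

theorem hasDerivAt_vec_two (hg : DifferentiableAt ℝ g ![x, y, z]) :
    HasDerivAt (fun s => g ![x, y, s]) (coordDeriv 2 g ![x, y, z]) z := by
  refine (hasDerivAt_update_of_differentiableAt hg 2).congr_of_eventuallyEq
    (Filter.Eventually.of_forall fun s => ?_)
  refine congrArg g ?_; ext i; fin_cases i <;> simp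

end threeVariables

/-- The second difference of `g` in the first and third variables. -/
def secondDiff (g : (Fin 3 → ℝ) → ℝ) (x x' z z' y : ℝ) : ℝ :=
  g ![x, y, z] - g ![x, y, z'] - (g ![x', y, z] - g ![x', y, z'])

/-- The mean value theorem, applied first in x and then in z. This needs the whole closed rectangle
inside Ω, not only its corners. -/
theorem exists_secondDiff_eq {g : (Fin 3 → ℝ) → ℝ} {Ω : Set (Fin 3 → ℝ)} (hΩ : IsOpen Ω)
    (hg : ContDiffOn ℝ ∞ g Ω) {x x' z z' y : ℝ}
    (h : ∀ s ∈ Set.uIcc x x', ∀ t ∈ Set.uIcc z z', ![s, y, t] ∈ Ω) :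
    ∃ s ∈ Set.uIcc x x', ∃ t ∈ Set.uIcc z z', secondDiff g x x' z z' y =
      (x - x') * (z - z') * coordDeriv 2 (coordDeriv 0 g) ![s, y, t] := by
  have hd : ∀ {g : (Fin 3 → ℝ) → ℝ}, ContDiffOn ℝ ∞ g Ω → ∀ p ∈ Ω, DifferentiableAt ℝ g p :=
    fun hg p hp => (hg.contDiffAt (hΩ.mem_nhds hp)).differentiableAt (by simp)
  obtain ⟨s, hs, e⟩ := exists_sub_eq_mul_deriv
    (f := fun s => g ![s, y, z] - g ![s, y, z'])
    (f' := fun s => coordDeriv 0 g ![s, y, z] - coordDeriv 0 g ![s, y, z']) (x := x) (x' := x')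
    fun s hs => (hasDerivAt_vec_zero (hd hg _ (h s hs z Set.left_mem_uIcc))).sub
      (hasDerivAt_vec_zero (hd hg _ (h s hs z' Set.right_mem_uIcc)))
  obtain ⟨t, ht, e'⟩ := exists_sub_eq_mul_deriv (f := fun t => coordDeriv 0 g ![s, y, t])
    (f' := fun t => coordDeriv 2 (coordDeriv 0 g) ![s, y, t]) (x := z) (x' := z')
    fun t ht => hasDerivAt_vec_two (hd (hg.coordDeriv hΩ 0) _ (h s hs t ht))
  refine ⟨s, hs, t, ht, ?_⟩
  rw [secondDiff, e, e', mul_assoc]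

theorem fullMixedDeriv_three (S : (Fin 3 → ℝ) → ℝ) :
    fullMixedDeriv S = coordDeriv 0 (coordDeriv 1 (coordDeriv 2 S)) := by
  simp [fullMixedDeriv, List.finRange_succ]

/-- Moves a y-derivative to the outside. Iterating it turns mixed derivatives of ∂₁S and ∂₁²S into
y-derivatives of the full mixed derivative, which are the quantities bounded by hypothesis. -/
theorem coordDeriv_two_zero_one_eqOn {g : (Fin 3 → ℝ) → ℝ} {Ω : Set (Fin 3 → ℝ)}
    (hΩ : IsOpen Ω) (hg : ContDiffOn ℝ ∞ g Ω) :
    Set.EqOn (coordDeriv 2 (coordDeriv 0 (coordDeriv 1 g)))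
      (coordDeriv 1 (coordDeriv 2 (coordDeriv 0 g))) Ω :=
  ((coordDeriv_comm hΩ hg 0 1).coordDeriv hΩ 2).trans
    (coordDeriv_comm hΩ (hg.coordDeriv hΩ 0) 2 1)

theorem fullMixedDeriv_three_eqOn {g : (Fin 3 → ℝ) → ℝ} {Ω : Set (Fin 3 → ℝ)}
    (hΩ : IsOpen Ω) (hg : ContDiffOn ℝ ∞ g Ω) :
    Set.EqOn (coordDeriv 2 (coordDeriv 0 (coordDeriv 1 g))) (fullMixedDeriv g) Ω := by
  rw [fullMixedDeriv_three]
  refine (coordDeriv_two_zero_one_eqOn hΩ hg).trans ?_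
  refine Set.EqOn.symm ?_
  exact (coordDeriv_comm hΩ (hg.coordDeriv hΩ 2) 0 1).trans
    ((coordDeriv_comm hΩ hg 0 2).coordDeriv hΩ 1)

theorem secondDiff_hasDerivAt {g : (Fin 3 → ℝ) → ℝ} {Ω : Set (Fin 3 → ℝ)} (hΩ : IsOpen Ω)
    (hg : ContDiffOn ℝ ∞ g Ω) {x x' z z' y : ℝ}
    (h : ∀ s ∈ Set.uIcc x x', ∀ t ∈ Set.uIcc z z', ![s, y, t] ∈ Ω) :
    HasDerivAt (secondDiff g x x' z z') (secondDiff (coordDeriv 1 g) x x' z z' y) y := by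
  have hd : ∀ p ∈ Ω, DifferentiableAt ℝ g p :=
    fun p hp => (hg.contDiffAt (hΩ.mem_nhds hp)).differentiableAt (by simp)
  exact ((hasDerivAt_vec_one (hd _ (h x Set.left_mem_uIcc z Set.left_mem_uIcc))).sub
    (hasDerivAt_vec_one (hd _ (h x Set.left_mem_uIcc z' Set.right_mem_uIcc)))).sub
    ((hasDerivAt_vec_one (hd _ (h x' Set.right_mem_uIcc z Set.left_mem_uIcc))).sub
    (hasDerivAt_vec_one (hd _ (h x' Set.right_mem_uIcc z' Set.right_mem_uIcc))))

/-! ### Integrals of the decaying kernel and the estimate on one cell -/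

theorem lintegral_inv_one_add_sq_mul (s : ℝ) (hs : 0 < s) (x : ℝ) :
    ∫⁻ x', ENNReal.ofReal (1 / (1 + (s * |x - x'|) ^ 2)) = ENNReal.ofReal (Real.pi / s) := by
  have h1 : ∀ x', ENNReal.ofReal (1 / (1 + (s * |x - x'|) ^ 2)) =
      ENNReal.ofReal ((1 + (s * (x - x')) ^ 2)⁻¹) := fun x' => by
    rw [mul_pow, sq_abs, ← mul_pow, one_div]
  simp only [h1]
  rw [lintegral_sub_left_eq_self (fun u => ENNReal.ofReal ((1 + (s * u) ^ 2)⁻¹)) x,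
    ← ofReal_integral_eq_lintegral_ofReal]
  · rw [Measure.integral_comp_mul_left (fun u => (1 + u ^ 2)⁻¹) s, integral_univ_inv_one_add_sq,
      abs_of_pos (inv_pos.2 hs), smul_eq_mul]
    congr 1; field_simp
  · exact integrable_inv_one_add_sq.comp_mul_left' hs.ne'
  · exact Filter.Eventually.of_forall fun u => by positivity

theorem lintegral_Ioc_rpow_neg_half (w : ℝ) (hw : 0 < w) :
    ∫⁻ u in Set.Ioc 0 w, ENNReal.ofReal |u| ^ (-(1 / 2) : ℝ) = ENNReal.ofReal (2 * √w) := by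
  have h1 : IntervalIntegrable (fun u : ℝ => u ^ (-(1 / 2) : ℝ)) volume 0 w :=
    intervalIntegral.intervalIntegrable_rpow' (by norm_num)
  have h2 : ∫ u in (0 : ℝ)..w, u ^ (-(1 / 2) : ℝ) = 2 * √w := by
    rw [integral_rpow (Or.inl (by norm_num)), Real.sqrt_eq_rpow]
    norm_num
    ring
  rw [← h2, intervalIntegral.integral_of_le hw.le, ofReal_integral_eq_lintegral_ofReal]
  · refine setLIntegral_congr_fun measurableSet_Ioc fun u hu => ?_
    rw [abs_of_pos hu.1, ENNReal.ofReal_rpow_of_pos hu.1]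
  · exact (intervalIntegrable_iff_integrableOn_Ioc_of_le hw.le).1 h1
  · filter_upwards [ae_restrict_mem measurableSet_Ioc] with u hu
    exact Real.rpow_nonneg hu.1.le _

theorem lintegral_Icc_rpow_neg_half_le (w : ℝ) (hw : 0 < w) :
    ∫⁻ u in Set.Icc (-w) w, ENNReal.ofReal |u| ^ (-(1 / 2) : ℝ) ≤ ENNReal.ofReal (4 * √w) := by
  have h1 : ∫⁻ u in Set.Ico (-w) 0, ENNReal.ofReal |u| ^ (-(1 / 2) : ℝ) =
      ∫⁻ u in Set.Ioc 0 w, ENNReal.ofReal |u| ^ (-(1 / 2) : ℝ) := by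
    have := (Measure.measurePreserving_neg (volume : Measure ℝ)).setLIntegral_comp_preimage_emb
      (MeasurableEquiv.neg ℝ).measurableEmbedding
      (fun u => ENNReal.ofReal |u| ^ (-(1 / 2) : ℝ)) (Set.Ioc 0 w)
    simpa [Set.neg_Ioc] using this
  have h2 : Set.Icc (-w) w ⊆ Set.Ico (-w) 0 ∪ ({0} ∪ Set.Ioc 0 w) := fun u hu => by
    rcases lt_trichotomy u 0 with h | h | h
    · exact Or.inl ⟨hu.1, h⟩
    · exact Or.inr (Or.inl h)
    · exact Or.inr (Or.inr ⟨h, hu.2⟩)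
  have hz : ∫⁻ u in ({0} : Set ℝ), ENNReal.ofReal |u| ^ (-(1 / 2) : ℝ) = 0 := by
    rw [Measure.restrict_eq_zero.2 (by simp), lintegral_zero_measure]
  calc _ ≤ ∫⁻ u in Set.Ico (-w) 0 ∪ ({0} ∪ Set.Ioc 0 w), ENNReal.ofReal |u| ^ (-(1 / 2) : ℝ) :=
        lintegral_mono_set h2
    _ ≤ _ := lintegral_union_le _ _ _
    _ ≤ _ := add_le_add le_rfl (lintegral_union_le _ _ _)
    _ = _ := by
      rw [h1, hz, zero_add, lintegral_Ioc_rpow_neg_half w hw,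
        ← ENNReal.ofReal_add (by positivity) (by positivity)]
      congr 1; ring

/-- Uniform in z, which may lie outside the interval. Distances at most w contribute at most 4√w,
and larger ones at most w · w^(-1/2) = √w. -/
theorem lintegral_Ioc_rpow_neg_half_sub_le (c w : ℝ) (hw : 0 < w) (z : ℝ) :
    ∫⁻ z' in Set.Ioc c (c + w), ENNReal.ofReal |z - z'| ^ (-(1 / 2) : ℝ) ≤
      ENNReal.ofReal (5 * √w) := by
  set g : ℝ → ℝ≥0∞ := (Set.Icc (-w) w).indicator fun u => ENNReal.ofReal |u| ^ (-(1 / 2) : ℝ)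
    with hg
  have hpt : ∀ u : ℝ, ENNReal.ofReal |u| ^ (-(1 / 2) : ℝ) ≤
      ENNReal.ofReal (w ^ (-(1 / 2) : ℝ)) + g u := fun u => by
    by_cases hu : u ∈ Set.Icc (-w) w
    · rw [hg, Set.indicator_of_mem hu]; exact le_add_self
    · have hu' : w < |u| := by
        rw [Set.mem_Icc, ← abs_le, not_le] at hu; exact hu
      refine le_trans ?_ le_self_add
      rw [ENNReal.ofReal_rpow_of_pos (hw.trans hu')]
      exact ENNReal.ofReal_le_ofReal
        (Real.rpow_le_rpow_of_nonpos hw hu'.le (by norm_num))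
  calc _ ≤ ∫⁻ z' in Set.Ioc c (c + w), (ENNReal.ofReal (w ^ (-(1 / 2) : ℝ)) + g (z - z')) :=
        lintegral_mono fun z' => hpt _
    _ = ENNReal.ofReal (w ^ (-(1 / 2) : ℝ)) * ENNReal.ofReal w +
          ∫⁻ z' in Set.Ioc c (c + w), g (z - z') := by
        rw [lintegral_add_left measurable_const]
        simp
    _ ≤ ENNReal.ofReal √w + ENNReal.ofReal (4 * √w) := by
        refine add_le_add (le_of_eq ?_) ?_
        · rw [← ENNReal.ofReal_mul (by positivity)]
          congr 1
          nth_rewrite 2 [← Real.rpow_one w]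
          rw [← Real.rpow_add hw, Real.sqrt_eq_rpow]
          norm_num
        · refine (setLIntegral_le_lintegral _ _).trans ?_
          rw [lintegral_sub_left_eq_self g z, hg, lintegral_indicator measurableSet_Icc]
          exact lintegral_Icc_rpow_neg_half_le w hw
    _ = _ := by
      rw [← ENNReal.ofReal_add (by positivity) (by positivity)]
      congr 1; ring

/-- The trilinear estimate on a cell, for a kernel with the decay given by nonstationary phase. -/
theorem enorm_trilinear_le_of_decay {β : Type*} [MeasurableSpace β] {ν : Measure β}
    [IsFiniteMeasure ν] {K : ℝ × β → ℝ → ℂ} {F : β × ℝ → ℂ} {G : ℝ × ℝ → ℂ}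
    {H : ℝ × β → ℂ} {M : ℝ} (hK : Measurable (Function.uncurry K)) (hF : Measurable F)
    (hG : Measurable G) (hH : Measurable H) (hKM : ∀ p z, ‖K p z‖ ≤ M) (hFM : ∀ p, ‖F p‖ ≤ M)
    (hGM : ∀ p, ‖G p‖ ≤ M) {c c' w w' X σ : ℝ} (hw' : 0 < w') (hX : 0 < X) (hσ : 0 < σ)
    (hdecay : ∀ x ∈ Set.Ioc c (c + w), ∀ x' ∈ Set.Ioc c (c + w), ∀ z ∈ Set.Ioc c' (c' + w'),
      ∀ z' ∈ Set.Ioc c' (c' + w'), ‖∫ y, K (x, y) z * starRingEnd ℂ (K (x, y) z') *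
      starRingEnd ℂ (K (x', y) z * starRingEnd ℂ (K (x', y) z')) ∂ν‖ ≤
        X * (1 / (1 + (σ * |z - z'| * |x - x'|) ^ 2))) :
    ‖trilinearForm (volume.restrict (Set.Ioc c (c + w))) ν
      (volume.restrict (Set.Ioc c' (c' + w'))) K F G H‖ₑ ^ 4 ≤
      ENNReal.ofReal (√(X * Real.pi / σ) * (5 * √w')) ^ 2 *
        (∫⁻ p, ‖H p‖ₑ ^ 2 ∂((volume.restrict (Set.Ioc c (c + w))).prod ν)) ^ 2 *
        (∫⁻ p, ‖F p‖ₑ ^ 4 ∂(ν.prod (volume.restrict (Set.Ioc c' (c' + w'))))) *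
        ∫⁻ p, ‖G p‖ₑ ^ 4 ∂((volume.restrict (Set.Ioc c (c + w))).prod
          (volume.restrict (Set.Ioc c' (c' + w')))) := by
  set Y := X * Real.pi / σ with hY
  have hY0 : 0 < Y := by positivity
  refine enorm_trilinear_le hK hF hG hH hKM hFM hGM
    -- κ is chosen so that κ² is the integral of k over all real x', namely Xπ / (σ|z - z'|).
    (k := fun z z' x x' => ENNReal.ofReal (X * (1 / (1 + (σ * |z - z'| * |x - x'|) ^ 2))))
    (κ := fun z z' => ENNReal.ofReal √Y * ENNReal.ofReal |z - z'| ^ (-(1 / 2) : ℝ))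
    ?_ ?_ ?_ ?_ ?_ ?_ ?_
  · intro z z'
    simp only [Function.uncurry_def]
    fun_prop
  · intro z z' x x'
    rw [abs_sub_comm x x']
  · simp only [Function.uncurry_def]
    fun_prop
  · intro z z'
    rw [abs_sub_comm z z']
  · filter_upwards [ae_restrict_mem measurableSet_Ioc] with z hz
    filter_upwards [ae_restrict_mem measurableSet_Ioc] with z' hz'
    filter_upwards [ae_restrict_mem measurableSet_Ioc] with x hx
    filter_upwards [ae_restrict_mem measurableSet_Ioc] with x' hx'
    rw [← ofReal_norm]
    exact ENNReal.ofReal_le_ofReal (hdecay x hx x' hx' z hz z' hz')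
  · intro z z' x
    rcases eq_or_ne z z' with rfl | hzz
    -- On the diagonal κ is ⊤, since 0 to a negative power is ⊤; the bound is then trivial.
    · rw [sub_self, abs_zero, ENNReal.ofReal_zero, ENNReal.zero_rpow_of_neg (by norm_num),
        ENNReal.mul_top (by simpa using hY0)]
      simp
    · have hd : 0 < |z - z'| := abs_pos.2 (sub_ne_zero.2 hzz)
      refine (setLIntegral_le_lintegral _ _).trans ?_
      simp only [ENNReal.ofReal_mul hX.le]
      rw [lintegral_const_mul' _ _ ENNReal.ofReal_ne_top,
        lintegral_inv_one_add_sq_mul _ (by positivity), ENNReal.ofReal_rpow_of_pos hd,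
        ← ENNReal.ofReal_mul (by positivity), ← ENNReal.ofReal_mul (by positivity),
        ← ENNReal.ofReal_pow (by positivity)]
      refine ENNReal.ofReal_le_ofReal (le_of_eq ?_)
      rw [mul_pow, Real.sq_sqrt hY0.le, ← Real.rpow_natCast, ← Real.rpow_mul hd.le]
      norm_num
      rw [Real.rpow_neg_one, hY]
      field_simp
  · intro z
    rw [lintegral_const_mul' _ _ ENNReal.ofReal_ne_top, ENNReal.ofReal_mul (by positivity)]
    exact mul_le_mul_right (lintegral_Ioc_rpow_neg_half_sub_le c' w' hw' z) _

/-! ### Decay of the iterated kernel at one level of the cutoff -/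

/-- The assumptions on the phase and on the cutoff. -/
structure AdmissiblePair (S : (Fin 3 → ℝ) → ℝ) (ψ : (Fin 3 → ℝ) → ℂ) (Ω : Set (Fin 3 → ℝ))
    (a b : Fin 3 → ℝ) (μ C₁ C₂ : ℝ) : Prop where
  contDiff : ContDiff ℝ ∞ ψ
  isOpen : IsOpen Ω
  tsupport_subset : tsupport ψ ⊆ Ω
  contDiffOn : ContDiffOn ℝ ∞ S Ω
  width_pos : ∀ j, 0 < b j
  mu_pos : 0 < μ
  tsupport_subset_Icc : tsupport ψ ⊆ Set.Icc a (a + b)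
  local_estimate : ∀ j, LocalEstimateHypotheses S ψ j (b j) μ C₁ C₂

/-- The kernel `e^{iλS} g(ψ)`. -/
noncomputable def oscKernel (lam : ℝ) (S : (Fin 3 → ℝ) → ℝ) (ψ : (Fin 3 → ℝ) → ℂ) (g : ℂ → ℂ)
    (p : ℝ × ℝ) (z : ℝ) : ℂ :=
  Complex.exp (Complex.I * ((lam * S ![p.1, p.2, z] : ℝ) : ℂ)) * g (ψ ![p.1, p.2, z])

theorem contDiff_levelPart (h : ℝ) : ContDiff ℝ ∞ (levelPart h) :=
  (contDiff_levelCutoff.comp (contDiff_const_smul h⁻¹)).const_smul h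

theorem levelPart_zero (h : ℝ) : levelPart h 0 = 0 := by simp [levelPart, levelCutoff]

theorem norm_exp_I_mul_ofReal (t : ℝ) : ‖Complex.exp (Complex.I * (t : ℂ))‖ = 1 := by
  rw [mul_comm]; exact Complex.norm_exp_ofReal_mul_I t

/-- Multiplication by `e^{iλS}` preserves continuity of functions of `ψ` that vanish at `0`. -/
theorem continuous_exp_mul_comp {S : (Fin 3 → ℝ) → ℝ} {ψ : (Fin 3 → ℝ) → ℂ}
    {Ω : Set (Fin 3 → ℝ)} (hψ : Continuous ψ) (hΩ : IsOpen Ω) (hsub : tsupport ψ ⊆ Ω)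
    (hS : ContinuousOn S Ω) (lam : ℝ) {g : ℂ → ℂ} (hg : Continuous g) (hg0 : g 0 = 0) :
    Continuous fun v => Complex.exp (Complex.I * ((lam * S v : ℝ) : ℂ)) * g (ψ v) := by
  refine continuous_iff_continuousAt.2 fun v => ?_
  by_cases hv : v ∈ tsupport ψ
  · have := hS.continuousAt (hΩ.mem_nhds (hsub hv))
    have := hψ.continuousAt (x := v)
    fun_prop
  · have : (fun v => Complex.exp (Complex.I * ((lam * S v : ℝ) : ℂ)) * g (ψ v)) =ᶠ[nhds v]
        fun _ => 0 := by
      filter_upwards [notMem_tsupport_iff_eventuallyEq.1 hv] with s hs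
      simp [hs, hg0]
    exact continuousAt_const.congr this.symm

namespace AdmissiblePair

variable {S : (Fin 3 → ℝ) → ℝ} {ψ : (Fin 3 → ℝ) → ℂ} {Ω : Set (Fin 3 → ℝ)} {a b : Fin 3 → ℝ}
  {μ C₁ C₂ : ℝ}

theorem norm_le (h : AdmissiblePair S ψ Ω a b μ C₁ C₂) (v : Fin 3 → ℝ) : ‖ψ v‖ ≤ C₁ := by
  simpa using (h.local_estimate 0).cutoff_bound 0 (by norm_num) v

theorem norm_coordDeriv_le (h : AdmissiblePair S ψ Ω a b μ C₁ C₂) (j : Fin 3) (v : Fin 3 → ℝ) :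
    ‖coordDeriv j ψ v‖ ≤ C₁ / b j := by
  have := (h.local_estimate j).cutoff_bound 1 (by norm_num) v
  simpa [div_eq_mul_inv] using this

theorem norm_coordDeriv_coordDeriv_le (h : AdmissiblePair S ψ Ω a b μ C₁ C₂) (j : Fin 3)
    (v : Fin 3 → ℝ) : ‖coordDeriv j (coordDeriv j ψ) v‖ ≤ C₁ / b j ^ 2 := by
  have := (h.local_estimate j).cutoff_bound 2 le_rfl v
  simpa [div_eq_mul_inv, zpow_neg, zpow_ofNat] using this

theorem hasScaleBound (h : AdmissiblePair S ψ Ω a b μ C₁ C₂) (x z : ℝ) :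
    HasScaleBound (fun t => ψ ![x, t, z]) C₁ (b 1) (fun t => coordDeriv 1 ψ ![x, t, z])
      (fun t => coordDeriv 1 (coordDeriv 1 ψ) ![x, t, z]) := by
  have h1 : Differentiable ℝ ψ := h.contDiff.differentiable (by simp)
  have h2 : Differentiable ℝ (coordDeriv 1 ψ) := by
    have := (contDiffOn_univ.2 h.contDiff).coordDeriv isOpen_univ 1
    exact (contDiffOn_univ.1 this).differentiable (by simp)
  exact ⟨fun t => hasDerivAt_vec_one (h1 _), fun t => hasDerivAt_vec_one (h2 _),
    fun t => h.norm_le _, fun t => h.norm_coordDeriv_le 1 _,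
    fun t => h.norm_coordDeriv_coordDeriv_le 1 _⟩

theorem norm_sub_le (h : AdmissiblePair S ψ Ω a b μ C₁ C₂) (x s y z t : ℝ) :
    ‖ψ ![s, y, t] - ψ ![x, y, z]‖ ≤ C₁ / b 0 * |s - x| + C₁ / b 2 * |t - z| := by
  have h1 : Differentiable ℝ ψ := h.contDiff.differentiable (by simp)
  have e1 : ‖ψ ![s, y, t] - ψ ![x, y, t]‖ ≤ C₁ / b 0 * ‖s - x‖ :=
    Convex.norm_image_sub_le_of_norm_hasDerivWithin_le (f := fun s => ψ ![s, y, t])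
      (fun s _ => (hasDerivAt_vec_zero (h1 _)).hasDerivWithinAt)
      (fun s _ => h.norm_coordDeriv_le 0 _) convex_univ (Set.mem_univ _) (Set.mem_univ _)
  have e2 : ‖ψ ![x, y, t] - ψ ![x, y, z]‖ ≤ C₁ / b 2 * ‖t - z‖ :=
    Convex.norm_image_sub_le_of_norm_hasDerivWithin_le (f := fun t => ψ ![x, y, t])
      (fun s _ => (hasDerivAt_vec_two (h1 _)).hasDerivWithinAt)
      (fun s _ => h.norm_coordDeriv_le 2 _) convex_univ (Set.mem_univ _) (Set.mem_univ _)
  calc _ = ‖(ψ ![s, y, t] - ψ ![x, y, t]) + (ψ ![x, y, t] - ψ ![x, y, z])‖ := by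
        rw [sub_add_sub_cancel]
    _ ≤ _ := (norm_add_le _ _).trans (add_le_add e1 e2)

/-- Moving x and z within these distances changes ψ by at most C₁δ/32 + C₁δ/32 = C₁δ/16, too little
to reach 0 from above C₁δ/4. This is what allows the phase hypotheses, known only on the support, to
be used throughout the rectangle. -/
theorem mem_support_of_lt (h : AdmissiblePair S ψ Ω a b μ C₁ C₂) (hC₁ : 0 < C₁) {δ : ℝ}
    (hδ : 0 < δ) {x x' y z z' : ℝ} (hx : |x - x'| ≤ b 0 * δ / 32) (hz : |z - z'| ≤ b 2 * δ / 32)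
    (hy : C₁ * δ / 4 < ‖ψ ![x, y, z]‖) {s t : ℝ} (hs : s ∈ Set.uIcc x x')
    (ht : t ∈ Set.uIcc z z') : ![s, y, t] ∈ tsupport ψ := by
  refine subset_tsupport _ (Function.mem_support.2 fun h0 => ?_)
  have h1 := h.norm_sub_le x s y z t
  rw [h0, zero_sub, norm_neg] at h1
  have hb0 := h.width_pos 0
  have hb2 := h.width_pos 2
  have h2 : |s - x| ≤ b 0 * δ / 32 := by
    refine le_trans ?_ hx
    rw [abs_sub_comm x x']
    exact Set.abs_sub_left_of_mem_uIcc hs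
  have h3 : |t - z| ≤ b 2 * δ / 32 := by
    refine le_trans ?_ hz
    rw [abs_sub_comm z z']
    exact Set.abs_sub_left_of_mem_uIcc ht
  have h4 : C₁ / b 0 * |s - x| + C₁ / b 2 * |t - z| ≤
      C₁ / b 0 * (b 0 * δ / 32) + C₁ / b 2 * (b 2 * δ / 32) := by gcongr
  have h5 : C₁ / b 0 * (b 0 * δ / 32) + C₁ / b 2 * (b 2 * δ / 32) = C₁ * δ / 16 := by
    field_simp; norm_num
  have : 0 < C₁ * δ := by positivity
  linarith

theorem apply_eq_zero_of_notMem_Icc (h : AdmissiblePair S ψ Ω a b μ C₁ C₂) {x y z : ℝ}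
    (hy : y ∉ Set.Icc (a 1) (a 1 + b 1)) : ψ ![x, y, z] = 0 := by
  by_contra hne
  have := h.tsupport_subset_Icc (subset_tsupport _ (Function.mem_support.2 hne))
  exact hy ⟨this.1 1, this.2 1⟩

/-- The y-derivatives of the second difference are second differences of y-derivatives of S. The
mean value theorem turns these into (x - x')(z - z') times D₃S, ∂₁D₃S and ∂₁²D₃S, at points of the
support of ψ. -/
theorem isOscillatory (h : AdmissiblePair S ψ Ω a b μ C₁ C₂) {x x' y z z' : ℝ}
    (hsupp : ∀ s ∈ Set.uIcc x x', ∀ t ∈ Set.uIcc z z', ![s, y, t] ∈ tsupport ψ) :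
    μ * (|x - x'| * |z - z'|) ≤ |secondDiff (coordDeriv 1 S) x x' z z' y| ∧
    |secondDiff (coordDeriv 1 (coordDeriv 1 S)) x x' z z' y| ≤
      C₂ * (μ * (|x - x'| * |z - z'|)) / b 1 ∧
    |secondDiff (coordDeriv 1 (coordDeriv 1 (coordDeriv 1 S))) x x' z z' y| ≤
      C₂ * (μ * (|x - x'| * |z - z'|)) / b 1 ^ 2 := by
  have hΩ := h.isOpen
  have hS := h.contDiffOn
  have hS1 := hS.coordDeriv hΩ 1
  have hS2 := hS1.coordDeriv hΩ 1
  have hS3 := hS2.coordDeriv hΩ 1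
  have hin : ∀ s ∈ Set.uIcc x x', ∀ t ∈ Set.uIcc z z', ![s, y, t] ∈ Ω :=
    fun s hs t ht => h.tsupport_subset (hsupp s hs t ht)
  have E1 := fullMixedDeriv_three_eqOn hΩ hS
  have E2 : Set.EqOn (coordDeriv 2 (coordDeriv 0 (coordDeriv 1 (coordDeriv 1 S))))
      (coordDeriv 1 (fullMixedDeriv S)) Ω :=
    (coordDeriv_two_zero_one_eqOn hΩ hS1).trans (E1.coordDeriv hΩ 1)
  have E3 : Set.EqOn (coordDeriv 2 (coordDeriv 0 (coordDeriv 1 (coordDeriv 1 (coordDeriv 1 S)))))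
      (coordDeriv 1 (coordDeriv 1 (fullMixedDeriv S))) Ω :=
    (coordDeriv_two_zero_one_eqOn hΩ hS2).trans (E2.coordDeriv hΩ 1)
  have L := h.local_estimate 1
  refine ⟨?_, ?_, ?_⟩
  · obtain ⟨s, hs, t, ht, e⟩ := exists_secondDiff_eq hΩ hS1 hin
    rw [e, E1 (hin s hs t ht), abs_mul, abs_mul, mul_comm]
    exact mul_le_mul_of_nonneg_left (L.le_phase _ (hsupp s hs t ht)) (by positivity)
  · obtain ⟨s, hs, t, ht, e⟩ := exists_secondDiff_eq hΩ hS2 hin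
    rw [e, E2 (hin s hs t ht), abs_mul, abs_mul]
    refine (mul_le_mul_of_nonneg_left (L.phase_bound_one _ (hsupp s hs t ht))
      (by positivity)).trans (le_of_eq ?_)
    rw [zpow_neg_one]; ring
  · obtain ⟨s, hs, t, ht, e⟩ := exists_secondDiff_eq hΩ hS3 hin
    rw [e, E3 (hin s hs t ht), abs_mul, abs_mul]
    refine (mul_le_mul_of_nonneg_left (L.phase_bound_two _ (hsupp s hs t ht))
      (by positivity)).trans (le_of_eq ?_)
    rw [zpow_neg, zpow_ofNat]; ring

/-- The trivial bound and the non-stationary phase bound are added, whence the leading factor 2. The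
constant 64 = 4³ comes from the three products that join the four amplitudes. -/
theorem norm_integral_oscKernel_levelPart_le (h : AdmissiblePair S ψ Ω a b μ C₁ C₂) (hC₁ : 0 < C₁)
    (hC₂ : 0 ≤ C₂) {M lam δ : ℝ} (hlam : lam ≠ 0) (hδ : 0 < δ) (hδ' : δ ≤ 1)
    (hM : ∀ z, ‖levelCutoff z‖ ≤ M ∧
      ‖fderiv ℝ levelCutoff z‖ ≤ M ∧ ‖fderiv ℝ (fderiv ℝ levelCutoff) z‖ ≤ M)
    {x x' z z' : ℝ} (hx : |x - x'| ≤ b 0 * δ / 32) (hz : |z - z'| ≤ b 2 * δ / 32) :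
    ‖∫ y in Set.Icc (a 1) (a 1 + b 1), oscKernel lam S ψ (levelPart (C₁ * δ)) (x, y) z *
        starRingEnd ℂ (oscKernel lam S ψ (levelPart (C₁ * δ)) (x, y) z') *
        starRingEnd ℂ (oscKernel lam S ψ (levelPart (C₁ * δ)) (x', y) z *
          starRingEnd ℂ (oscKernel lam S ψ (levelPart (C₁ * δ)) (x', y) z'))‖ ≤
      2 * (1 + 4 * C₂ + 3 * C₂ ^ 2) * (b 1 * (64 * (2 * M * (C₁ * δ)) ^ 4)) *
        (1 / (1 + (|lam| * μ * (δ * b 1) * |z - z'| * |x - x'|) ^ 2)) := by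
  have hb := h.width_pos 1
  have hμ := h.mu_pos
  obtain ⟨p₁, p₂, hp⟩ := (h.hasScaleBound x z).levelPart hC₁ hb hδ hδ' hM
  obtain ⟨q₁, q₂, hq⟩ := (h.hasScaleBound x z').levelPart hC₁ hb hδ hδ' hM
  obtain ⟨r₁, r₂, hr⟩ := (h.hasScaleBound x' z).levelPart hC₁ hb hδ hδ' hM
  obtain ⟨s₁, s₂, hs⟩ := (h.hasScaleBound x' z').levelPart hC₁ hb hδ hδ' hM
  have hA := (hp.mul hq.conj).mul (hr.mul hs.conj).conj
  set A₀ := 64 * (2 * M * (C₁ * δ)) ^ 4 with hA₀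
  rw [show 4 * (4 * (2 * M * (C₁ * δ) * (2 * M * (C₁ * δ))) *
    (4 * (2 * M * (C₁ * δ) * (2 * M * (C₁ * δ))))) = A₀ by rw [hA₀]; ring] at hA
  set A : ℝ → ℂ := fun y => levelPart (C₁ * δ) (ψ ![x, y, z]) *
    starRingEnd ℂ (levelPart (C₁ * δ) (ψ ![x, y, z'])) *
    starRingEnd ℂ (levelPart (C₁ * δ) (ψ ![x', y, z]) *
      starRingEnd ℂ (levelPart (C₁ * δ) (ψ ![x', y, z']))) with hAdef
  have hA₀0 : 0 ≤ A₀ := by positivity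
  have hint : ∀ y, oscKernel lam S ψ (levelPart (C₁ * δ)) (x, y) z *
        starRingEnd ℂ (oscKernel lam S ψ (levelPart (C₁ * δ)) (x, y) z') *
        starRingEnd ℂ (oscKernel lam S ψ (levelPart (C₁ * δ)) (x', y) z *
          starRingEnd ℂ (oscKernel lam S ψ (levelPart (C₁ * δ)) (x', y) z')) =
      Complex.exp (Complex.I * ((lam * secondDiff S x x' z z' y : ℝ) : ℂ)) * A y := fun y => by
    have hexp : Complex.exp (Complex.I * ((lam * secondDiff S x x' z z' y : ℝ) : ℂ)) =
        Complex.exp (Complex.I * ((lam * S ![x, y, z] : ℝ) : ℂ)) *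
        starRingEnd ℂ (Complex.exp (Complex.I * ((lam * S ![x, y, z'] : ℝ) : ℂ))) *
        starRingEnd ℂ (Complex.exp (Complex.I * ((lam * S ![x', y, z] : ℝ) : ℂ)) *
          starRingEnd ℂ (Complex.exp (Complex.I * ((lam * S ![x', y, z'] : ℝ) : ℂ)))) := by
      rw [map_mul, Complex.conj_conj]
      simp only [← Complex.exp_conj, map_mul, Complex.conj_I, Complex.conj_ofReal,
        ← Complex.exp_add, secondDiff]
      congr 1
      push_cast
      ring
    rw [hexp]
    simp only [oscKernel, hAdef, map_mul, Complex.conj_conj]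
    ring
  simp only [hint]
  have hAz : ∀ y ∉ Set.Icc (a 1) (a 1 + b 1), A y = 0 := fun y hy => by
    simp [hAdef, h.apply_eq_zero_of_notMem_Icc hy, levelPart_zero]
  set c := 1 + 4 * C₂ + 3 * C₂ ^ 2 with hc
  have hc1 : 1 ≤ c := by nlinarith
  set I := ∫ y in Set.Icc (a 1) (a 1 + b 1),
    Complex.exp (Complex.I * ((lam * secondDiff S x x' z z' y : ℝ) : ℂ)) * A y with hI
  have htriv : ‖I‖ ≤ c * (b 1 * A₀) := by
    calc ‖I‖ ≤ A₀ * volume.real (Set.Icc (a 1) (a 1 + b 1)) :=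
          norm_setIntegral_le_of_norm_le_const (by simp) fun y _ => by
            rw [norm_mul, norm_exp_I_mul_ofReal, one_mul]; exact hA.2.2.1 y
      _ = 1 * (b 1 * A₀) := by
          rw [Real.volume_real_Icc_of_le (by linarith)]; ring
      _ ≤ _ := mul_le_mul_of_nonneg_right hc1 (by positivity)
  have hmain : ‖I‖ * (|lam| * μ * (δ * b 1) * |z - z'| * |x - x'|) ^ 2 ≤ c * (b 1 * A₀) := by
    rcases eq_or_ne x x' with rfl | hxx
    · simp only [sub_self, abs_zero, mul_zero]; rw [zero_pow two_ne_zero, mul_zero]; positivity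
    rcases eq_or_ne z z' with rfl | hzz
    · simp only [sub_self, abs_zero, mul_zero, zero_mul]
      rw [zero_pow two_ne_zero, mul_zero]; positivity
    have hdx : 0 < |x - x'| := abs_pos.2 (sub_ne_zero.2 hxx)
    have hdz : 0 < |z - z'| := abs_pos.2 (sub_ne_zero.2 hzz)
    -- The support of the level piece lies in |ψ| ≥ C₁δ/2 even after taking the closure; the
    -- threshold C₁δ/4 is below this and is the one that keeps the rectangle in the support.
    set U : Set ℝ := {y | C₁ * δ / 4 < ‖ψ ![x, y, z]‖} with hU
    have hψc : Continuous fun y => ‖ψ ![x, y, z]‖ := by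
      have := h.contDiff.continuous
      fun_prop
    have hh : 0 < C₁ * δ := by positivity
    have hAU : tsupport A ⊆ U := by
      have : tsupport A ⊆ {y | C₁ * δ / 2 ≤ ‖ψ ![x, y, z]‖} := by
        refine closure_minimal (fun y hy => ?_) (isClosed_le continuous_const hψc)
        refine (lt_norm_of_levelPart_ne_zero hh fun h0 => hy ?_).le
        simp [hAdef, h0]
      refine this.trans fun y hy => ?_
      simp only [Set.mem_ofPred_eq, hU] at hy ⊢
      linarith
    have hsuppA : tsupport A ⊆ Set.Icc (a 1) (a 1 + b 1) :=
      closure_minimal (fun y hy => by_contra fun hn => hy (hAz y hn)) isClosed_Icc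
    have hrect : ∀ y ∈ U, ∀ s ∈ Set.uIcc x x', ∀ t ∈ Set.uIcc z z', ![s, y, t] ∈ tsupport ψ :=
      fun y hy s hs t ht => h.mem_support_of_lt hC₁ hδ hx hz hy hs ht
    have hrectΩ : ∀ y ∈ U, ∀ s ∈ Set.uIcc x x', ∀ t ∈ Set.uIcc z z', ![s, y, t] ∈ Ω :=
      fun y hy s hs t ht => h.tsupport_subset (hrect y hy s hs t ht)
    have hΩ := h.isOpen
    have hS := h.contDiffOn
    have hS1 := hS.coordDeriv hΩ 1
    have hS2 := hS1.coordDeriv hΩ 1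
    have hθ : 0 < μ * (|x - x'| * |z - z'|) := by positivity
    have hIR : I = ∫ y, Complex.exp (Complex.I *
        ((lam * secondDiff S x x' z z' y : ℝ) : ℂ)) * A y :=
      setIntegral_eq_integral_of_forall_compl_eq_zero fun y hy => by rw [hAz y hy, mul_zero]
    have key := norm_integral_exp_mul_le (c := C₂) hlam (mul_pos hδ hb) hθ hC₂ hb.le hAU hA hsuppA
      (v := secondDiff S x x' z z') (p := secondDiff (coordDeriv 1 S) x x' z z')
      (p₁ := secondDiff (coordDeriv 1 (coordDeriv 1 S)) x x' z z')
      (p₂ := secondDiff (coordDeriv 1 (coordDeriv 1 (coordDeriv 1 S))) x x' z z')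
      (fun y hy => secondDiff_hasDerivAt hΩ hS (hrectΩ y hy))
      (fun y hy => secondDiff_hasDerivAt hΩ hS1 (hrectΩ y hy))
      (fun y hy => secondDiff_hasDerivAt hΩ hS2 (hrectΩ y hy))
      (fun y hy => (h.isOscillatory (hrect y hy)).1)
      -- The phase varies at scale `b 1`; since δ ≤ 1, its bounds may be weakened to the scale `δ *
      -- b 1` of the amplitude.
      (fun y hy => (h.isOscillatory (hrect y hy)).2.1.trans
        (div_le_div_of_nonneg_left (by positivity) (by positivity)
          (mul_le_of_le_one_left hb.le hδ')))
      (fun y hy => (h.isOscillatory (hrect y hy)).2.2.trans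
        (div_le_div_of_nonneg_left (by positivity) (by positivity)
          (pow_le_pow_left₀ (by positivity) (mul_le_of_le_one_left hb.le hδ') 2)))
    rw [← hIR] at key
    have hlam2 : (0 : ℝ) < (lam * (μ * (|x - x'| * |z - z'|)) * (δ * b 1)) ^ 2 := by positivity
    rw [le_div_iff₀ hlam2] at key
    refine le_trans (le_of_eq ?_) key
    simp only [mul_pow, sq_abs]
    ring
  set T := |lam| * μ * (δ * b 1) * |z - z'| * |x - x'|
  rw [mul_one_div, le_div_iff₀ (by positivity)]
  linarith

end AdmissiblePair

/-! ### Summation over cells and over levels -/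

theorem continuous_vec_three : Continuous fun q : (ℝ × ℝ) × ℝ => ![q.1.1, q.1.2, q.2] := by
  refine continuous_pi fun i => ?_
  fin_cases i <;> simp <;> fun_prop

theorem norm_oscKernel_le {lam : ℝ} {S : (Fin 3 → ℝ) → ℝ} {ψ : (Fin 3 → ℝ) → ℂ} {g : ℂ → ℂ}
    {M : ℝ} (hg : ∀ v, ‖g (ψ v)‖ ≤ M) (p : ℝ × ℝ) (z : ℝ) : ‖oscKernel lam S ψ g p z‖ ≤ M := by
  rw [oscKernel, norm_mul, norm_exp_I_mul_ofReal, one_mul]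
  exact hg _

/-- The part of `z` where `‖z‖` is larger than `h`. -/
noncomputable def highPart (h : ℝ) (z : ℂ) : ℂ := smoothStep (‖z‖ ^ 2 / h ^ 2) • z

theorem continuous_highPart (h : ℝ) : Continuous (highPart h) := by
  have := contDiff_smoothStep.continuous
  unfold highPart
  fun_prop

theorem smoothStep_mem_Icc (s : ℝ) : smoothStep s ∈ Set.Icc 0 1 :=
  ⟨Real.smoothTransition.nonneg _, Real.smoothTransition.le_one _⟩

theorem norm_sub_highPart_le {h : ℝ} (hh : 0 < h) (z : ℂ) : ‖z - highPart h z‖ ≤ 2 * h := by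
  have h1 := smoothStep_mem_Icc (‖z‖ ^ 2 / h ^ 2)
  rw [highPart]
  nth_rewrite 1 [← one_smul ℝ z]
  rw [← sub_smul, norm_smul, Real.norm_of_nonneg (by linarith [h1.2])]
  rcases le_or_gt ‖z‖ (2 * h) with hz | hz
  · calc _ ≤ 1 * ‖z‖ := mul_le_mul_of_nonneg_right (by linarith [h1.1]) (norm_nonneg _)
      _ ≤ _ := by linarith
  · rw [smoothStep_of_two_le]
    · simp; linarith
    · rw [le_div_iff₀ (by positivity)]; nlinarith

theorem norm_highPart_le (h : ℝ) (z : ℂ) : ‖highPart h z‖ ≤ ‖z‖ := by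
  have h1 := smoothStep_mem_Icc (‖z‖ ^ 2 / h ^ 2)
  rw [highPart, norm_smul, Real.norm_of_nonneg h1.1]
  exact mul_le_of_le_one_left (norm_nonneg _) h1.2

/-- The telescoping step: lowering the threshold by a factor 2 adds exactly one level. -/
theorem highPart_half {h : ℝ} (hh : 0 < h) (z : ℂ) :
    highPart (h / 2) z = highPart h z + levelPart h z := by
  rw [levelPart_eq hh, highPart, highPart]; ring

theorem highPart_eq_zero {h : ℝ} (hh : 0 < h) {z : ℂ} (hz : ‖z‖ ≤ h) : highPart h z = 0 := by
  rw [highPart, smoothStep_of_le_one, zero_smul]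
  rw [div_le_one (by positivity)]
  exact pow_le_pow_left₀ (norm_nonneg _) hz 2

theorem norm_levelPart_le {h : ℝ} (hh : 0 < h) (z : ℂ) : ‖levelPart h z‖ ≤ 2 * ‖z‖ := by
  have e := highPart_half hh z
  have e' : levelPart h z = highPart (h / 2) z - highPart h z := by rw [e]; ring
  rw [e']
  refine (norm_sub_le _ _).trans ?_
  linarith [norm_highPart_le h z, norm_highPart_le (h / 2) z]

namespace AdmissiblePair

variable {S : (Fin 3 → ℝ) → ℝ} {ψ : (Fin 3 → ℝ) → ℂ} {Ω : Set (Fin 3 → ℝ)} {a b : Fin 3 → ℝ}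
  {μ C₁ C₂ : ℝ}

theorem measurable_oscKernel (h : AdmissiblePair S ψ Ω a b μ C₁ C₂) (lam : ℝ) {g : ℂ → ℂ}
    (hg : Continuous g) (hg0 : g 0 = 0) :
    Measurable (Function.uncurry (oscKernel lam S ψ g)) :=
  ((continuous_exp_mul_comp h.contDiff.continuous h.isOpen h.tsupport_subset
    h.contDiffOn.continuousOn lam hg hg0).comp continuous_vec_three).measurable

/-- The box is cut into 32·2^k intervals in x and as many in z, short enough for the kernel bound on
each cell. The powers of δ combine as δ⁴ · δ⁻¹ · δ · δ⁻³ = δ = 2^(-k), from `X`, `σ`, the cell width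
in z and the number of cells. -/
theorem enorm_trilinearForm_levelPart_le (h : AdmissiblePair S ψ Ω a b μ C₁ C₂) (hC₁ : 0 < C₁)
    (hC₂ : 0 ≤ C₂) {M lam : ℝ} (hlam : lam ≠ 0) (hM0 : 0 < M)
    (hM : ∀ z, ‖levelCutoff z‖ ≤ M ∧
      ‖fderiv ℝ levelCutoff z‖ ≤ M ∧ ‖fderiv ℝ (fderiv ℝ levelCutoff) z‖ ≤ M)
    {F G H : ℝ × ℝ → ℂ} {R : ℝ} (hF : Measurable F) (hG : Measurable G) (hH : Measurable H)
    (hFM : ∀ p, ‖F p‖ ≤ R) (hGM : ∀ p, ‖G p‖ ≤ R) (hHM : ∀ p, ‖H p‖ ≤ R) (k : ℕ) :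
    ‖trilinearForm (volume.restrict (Set.Ioc (a 0) (a 0 + b 0)))
      (volume.restrict (Set.Icc (a 1) (a 1 + b 1))) (volume.restrict (Set.Ioc (a 2) (a 2 + b 2)))
      (oscKernel lam S ψ (levelPart (C₁ * (1 / 2) ^ k))) F G H‖ₑ ^ 4 ≤
    ENNReal.ofReal ((1 + 4 * C₂ + 3 * C₂ ^ 2) * (M * C₁) ^ 4 * (52428800 * Real.pi) * (1 / 2) ^ k *
        (b 2 / (|lam| * μ))) *
      ((∫⁻ p, ‖H p‖ₑ ^ 2) ^ 2 * (∫⁻ p, ‖F p‖ₑ ^ 4) * ∫⁻ p, ‖G p‖ₑ ^ 4) := by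
  have hb := h.width_pos
  have hμ := h.mu_pos
  set δ : ℝ := (1 / 2) ^ k with hδ
  have hδ0 : 0 < δ := by positivity
  have hδ1 : δ ≤ 1 := pow_le_one₀ (by norm_num) (by norm_num)
  have hN : ∀ j, b j = (32 * 2 ^ k : ℕ) * (b j * δ / 32) := fun j => by
    rw [hδ]; push_cast; field_simp; rw [one_div, inv_pow]; field_simp
  set X := 2 * (1 + 4 * C₂ + 3 * C₂ ^ 2) * (b 1 * (64 * (2 * M * (C₁ * δ)) ^ 4)) with hX
  have hX0 : 0 < X := by have := hb 1; positivity
  set σ := |lam| * μ * (δ * b 1) with hσ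
  have hσ0 : 0 < σ := by have := hb 1; positivity
  have hKm : Measurable (Function.uncurry (oscKernel lam S ψ (levelPart (C₁ * δ)))) :=
    h.measurable_oscKernel lam (contDiff_levelPart _).continuous (levelPart_zero _)
  have hKb : ∀ p z, ‖oscKernel lam S ψ (levelPart (C₁ * δ)) p z‖ ≤ max (2 * C₁) R := fun p z =>
    (norm_oscKernel_le (fun v => (norm_levelPart_le (by positivity) _).trans
      (mul_le_mul_of_nonneg_left (h.norm_le v) (by norm_num))) p z).trans (le_max_left _ _)
  have hFM' : ∀ p, ‖F p‖ ≤ max (2 * C₁) R := fun p => (hFM p).trans (le_max_right _ _)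
  have hGM' : ∀ p, ‖G p‖ ≤ max (2 * C₁) R := fun p => (hGM p).trans (le_max_right _ _)
  have hHM' : ∀ p, ‖H p‖ ≤ max (2 * C₁) R := fun p => (hHM p).trans (le_max_right _ _)
  have key := enorm_trilinear_sum_le (Finset.range (32 * 2 ^ k))
    (μ := fun i => volume.restrict
      (Set.Ioc (a 0 + i * (b 0 * δ / 32)) (a 0 + i * (b 0 * δ / 32) + b 0 * δ / 32)))
    (ν := volume.restrict (Set.Icc (a 1) (a 1 + b 1)))
    (ρ := fun i => volume.restrict
      (Set.Ioc (a 2 + i * (b 2 * δ / 32)) (a 2 + i * (b 2 * δ / 32) + b 2 * δ / 32)))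
    hKm hF hG hH hKb hFM' hGM' hHM'
    (E := ENNReal.ofReal (√(X * Real.pi / σ) * (5 * √(b 2 * δ / 32))))
    fun i _ j _ => enorm_trilinear_le_of_decay hKm hF hG hH hKb hFM' hGM'
      (by have := hb 2; positivity) hX0 hσ0 fun x hx x' hx' z hz z' hz' => by
        refine h.norm_integral_oscKernel_levelPart_le hC₁ hC₂ hlam hδ0 hδ1 hM ?_ ?_
        · rw [abs_le]; constructor <;> linarith [hx.1, hx.2, hx'.1, hx'.2]
        · rw [abs_le]; constructor <;> linarith [hz.1, hz.2, hz'.1, hz'.2]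
  rw [← volume_restrict_Ioc_eq_sum _ _ (by have := hb 0; positivity),
    ← volume_restrict_Ioc_eq_sum _ _ (by have := hb 2; positivity), ← hN, ← hN] at key
  refine key.trans ?_
  rw [mul_assoc, mul_assoc, ← mul_assoc (_ ^ 2) (lintegral _ _)]
  refine mul_le_mul' (le_of_eq ?_) (mul_le_mul' (mul_le_mul' (pow_le_pow_left' ?_ 2) ?_) ?_)
  · rw [Finset.card_range, ← ENNReal.ofReal_natCast, ← ENNReal.ofReal_pow (by positivity),
      ← ENNReal.ofReal_pow (by positivity), ← ENNReal.ofReal_mul (by positivity)]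
    congr 1
    have hNδ : ((32 * 2 ^ k : ℕ) : ℝ) = 32 / δ := by
      rw [hδ]; push_cast; rw [one_div, inv_pow]; field_simp
    have hb2 := hb 2
    have hb1 := hb 1
    -- The numerical constant is 2 · 64 · 2⁴ from `X`, times 5² from Schur's test, times 32³ / 32
    -- from the cells: 2048 · 25 · 1024 = 52428800.
    rw [hNδ, mul_pow, mul_pow, Real.sq_sqrt (by positivity), Real.sq_sqrt (by positivity), hX, hσ]
    field_simp
    norm_num
  all_goals
    simp only [Measure.volume_eq_prod, Measure.prod_restrict]
    exact setLIntegral_le_lintegral _ _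

end AdmissiblePair

namespace AdmissiblePair

variable {S : (Fin 3 → ℝ) → ℝ} {ψ : (Fin 3 → ℝ) → ℂ} {Ω : Set (Fin 3 → ℝ)} {a b : Fin 3 → ℝ}
  {μ C₁ C₂ : ℝ}

/-- The main estimate for bounded functions. -/
theorem norm_trilinearForm_le (h : AdmissiblePair S ψ Ω a b μ C₁ C₂) (hC₁ : 0 < C₁)
    (hC₂ : 0 ≤ C₂) {M lam : ℝ} (hlam : lam ≠ 0) (hM0 : 0 < M)
    (hM : ∀ z, ‖levelCutoff z‖ ≤ M ∧
      ‖fderiv ℝ levelCutoff z‖ ≤ M ∧ ‖fderiv ℝ (fderiv ℝ levelCutoff) z‖ ≤ M)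
    {F G H : ℝ × ℝ → ℂ} {R Q : ℝ} (hF : Measurable F) (hG : Measurable G) (hH : Measurable H)
    (hFM : ∀ p, ‖F p‖ ≤ R) (hGM : ∀ p, ‖G p‖ ≤ R) (hHM : ∀ p, ‖H p‖ ≤ R) (hQ : 0 ≤ Q)
    (hQ' : (∫⁻ p, ‖H p‖ₑ ^ 2) ^ 2 * (∫⁻ p, ‖F p‖ₑ ^ 4) * ∫⁻ p, ‖G p‖ₑ ^ 4 ≤
      ENNReal.ofReal (Q ^ 4)) :
    ‖trilinearForm (volume.restrict (Set.Ioc (a 0) (a 0 + b 0)))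
      (volume.restrict (Set.Icc (a 1) (a 1 + b 1))) (volume.restrict (Set.Ioc (a 2) (a 2 + b 2)))
      (oscKernel lam S ψ id) F G H‖ ≤
    ((1 + 4 * C₂ + 3 * C₂ ^ 2) * (M * C₁) ^ 4 * (52428800 * Real.pi)) ^ (1 / 4 : ℝ) *
      (1 - (1 / 2 : ℝ) ^ (1 / 4 : ℝ))⁻¹ * (b 2 / (|lam| * μ)) ^ (1 / 4 : ℝ) * Q := by
  have hb := h.width_pos
  have hμ := h.mu_pos
  set B := (1 + 4 * C₂ + 3 * C₂ ^ 2) * (M * C₁) ^ 4 * (52428800 * Real.pi) with hB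
  have hB0 : 0 ≤ B := by positivity
  set r : ℝ := (1 / 2 : ℝ) ^ (1 / 4 : ℝ) with hr
  have hr0 : 0 ≤ r := by positivity
  have hr1 : r < 1 := Real.rpow_lt_one (by norm_num) (by norm_num) (by norm_num)
  have hbl : 0 ≤ b 2 / (|lam| * μ) := by have := hb 2; positivity
  have hroot : ∀ y : ℝ, 0 ≤ y → (y ^ (1 / 4 : ℝ)) ^ 4 = y := fun y hy => by
    rw [← Real.rpow_natCast, ← Real.rpow_mul hy]; norm_num
  set T := B ^ (1 / 4 : ℝ) * (b 2 / (|lam| * μ)) ^ (1 / 4 : ℝ) * Q with hT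
  have hT0 : 0 ≤ T := by positivity
  set Λ : (ℂ → ℂ) → ℂ := fun g =>
    trilinearForm (volume.restrict (Set.Ioc (a 0) (a 0 + b 0)))
      (volume.restrict (Set.Icc (a 1) (a 1 + b 1))) (volume.restrict (Set.Ioc (a 2) (a 2 + b 2)))
      (oscKernel lam S ψ g) F G H with hΛ
  have hlevel : ∀ k : ℕ, ‖Λ (levelPart (C₁ * (1 / 2) ^ k))‖ ≤ T * r ^ k := fun k => by
    have h1 := (h.enorm_trilinearForm_levelPart_le hC₁ hC₂ hlam hM0 hM hF hG hH hFM hGM hHM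
      k).trans (mul_le_mul_right hQ' _)
    rw [← ofReal_norm, ← ENNReal.ofReal_pow (norm_nonneg _), ← ENNReal.ofReal_mul (by positivity),
      ENNReal.ofReal_le_ofReal_iff (by positivity)] at h1
    refine (pow_le_pow_iff_left₀ (norm_nonneg _) (by positivity) (n := 4) (by norm_num)).1 ?_
    have e : (T * r ^ k) ^ 4 = B * (b 2 / (|lam| * μ)) * Q ^ 4 * (1 / 2) ^ k := by
      rw [hT, mul_pow, mul_pow, mul_pow, hroot B hB0, hroot _ hbl, ← pow_mul, mul_comm k 4,
        pow_mul, hr, hroot _ (by norm_num)]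
    refine h1.trans (le_of_eq ?_)
    rw [e, hB]
    ring
  have hadd : ∀ g g' : ℂ → ℂ, Continuous g → Continuous g' → g 0 = 0 → g' 0 = 0 →
      (∀ v, ‖g (ψ v)‖ ≤ 2 * C₁) → (∀ v, ‖g' (ψ v)‖ ≤ 2 * C₁) →
      Λ (fun z => g z + g' z) = Λ g + Λ g' := fun g g' hg hg' hg0 hg0' hgb hgb' => by
    simp only [hΛ]
    rw [← trilinearForm_add (h.measurable_oscKernel lam hg hg0)
      (h.measurable_oscKernel lam hg' hg0') hF hG hH (norm_oscKernel_le hgb)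
      (norm_oscKernel_le hgb') hFM hGM hHM]
    congr 1
    funext p z
    simp only [oscKernel, mul_add]
  have hhigh0 : ∀ t, highPart t 0 = 0 := fun t => by simp [highPart]
  have hhighb : ∀ t v, ‖highPart t (ψ v)‖ ≤ 2 * C₁ := fun t v =>
    (norm_highPart_le _ _).trans ((h.norm_le v).trans (by linarith))
  have hhigh : ∀ n : ℕ, ‖Λ (highPart (C₁ * (1 / 2) ^ n))‖ ≤ ∑ k ∈ Finset.range n, T * r ^ k := by
    intro n
    induction n with
    -- At the top threshold C₁ nothing remains, because |ψ| ≤ C₁.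
    | zero =>
      have := _root_.norm_trilinearForm_le (μ := volume.restrict (Set.Ioc (a 0) (a 0 + b 0)))
        (ν := volume.restrict (Set.Icc (a 1) (a 1 + b 1)))
        (ρ := volume.restrict (Set.Ioc (a 2) (a 2 + b 2)))
        (K := oscKernel lam S ψ (highPart (C₁ * (1 / 2) ^ 0))) (M := 0)
        (norm_oscKernel_le fun v => by
          rw [pow_zero, mul_one, highPart_eq_zero hC₁ (h.norm_le v), norm_zero]) hFM hGM hHM
      simpa using this
    | succ n ih =>
      have hh : 0 < C₁ * (1 / 2) ^ n := by positivity
      have e : highPart (C₁ * (1 / 2) ^ (n + 1)) = fun z =>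
          highPart (C₁ * (1 / 2) ^ n) z + levelPart (C₁ * (1 / 2) ^ n) z := by
        funext z
        rw [← highPart_half hh]
        congr 1; ring
      rw [e, hadd _ _ (continuous_highPart _) (contDiff_levelPart _).continuous (hhigh0 _)
        (levelPart_zero _) (hhighb _) fun v => (norm_levelPart_le hh _).trans
          (mul_le_mul_of_nonneg_left (h.norm_le v) (by norm_num)), Finset.sum_range_succ]
      exact (norm_add_le _ _).trans (add_le_add ih (hlevel n))
  have hgeom : ∀ n : ℕ, ∑ k ∈ Finset.range n, T * r ^ k ≤ T * (1 - r)⁻¹ := fun n => by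
    rw [← Finset.mul_sum, ← tsum_geometric_of_lt_one hr0 hr1]
    exact mul_le_mul_of_nonneg_left ((summable_geometric_of_lt_one hr0 hr1).sum_le_tsum _
      fun k _ => by positivity) hT0
  set V := R * R * (volume.restrict (Set.Ioc (a 2) (a 2 + b 2))).real Set.univ * R *
    ((volume.restrict (Set.Ioc (a 0) (a 0 + b 0))).prod
      (volume.restrict (Set.Icc (a 1) (a 1 + b 1)))).real Set.univ with hV
  -- The part below the threshold has kernel at most 2C₁2^(-n). Its contribution is bounded using
  -- the box and the sup norms; that bound is not uniform in R, but only its limit in n matters.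
  have hfinal : ∀ n : ℕ, ‖Λ id‖ ≤ T * (1 - r)⁻¹ + 2 * (C₁ * (1 / 2) ^ n) * V := fun n => by
    have hh : 0 < C₁ * (1 / 2) ^ n := by positivity
    have e : (id : ℂ → ℂ) = fun z => highPart (C₁ * (1 / 2) ^ n) z +
        (z - highPart (C₁ * (1 / 2) ^ n) z) := by funext z; simp
    have hle : C₁ * (1 / 2) ^ n ≤ C₁ :=
      mul_le_of_le_one_right hC₁.le (pow_le_one₀ (by norm_num) (by norm_num))
    rw [e, hadd _ (fun z => z - highPart (C₁ * (1 / 2) ^ n) z) (continuous_highPart _)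
      (continuous_id.sub (continuous_highPart _)) (hhigh0 _)
      (by simp [hhigh0]) (hhighb _) fun v => (norm_sub_highPart_le hh _).trans (by linarith)]
    refine (norm_add_le _ _).trans (add_le_add ((hhigh n).trans (hgeom n)) ?_)
    exact _root_.norm_trilinearForm_le
      (norm_oscKernel_le fun v => norm_sub_highPart_le hh _) hFM hGM hHM
  have hlim : Filter.Tendsto (fun n : ℕ => T * (1 - r)⁻¹ + 2 * (C₁ * (1 / 2) ^ n) * V)
      Filter.atTop (nhds (T * (1 - r)⁻¹ + 2 * (C₁ * 0) * V)) :=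
    ((((tendsto_pow_atTop_nhds_zero_of_lt_one (by norm_num) (by norm_num)).const_mul
      C₁).const_mul 2).mul_const V).const_add _
  refine (ge_of_tendsto' hlim hfinal).trans (le_of_eq ?_)
  rw [hT]; ring

end AdmissiblePair

/-! ### Absolute convergence and removal of boundedness -/

/-- The integrand of the trilinear form on `(ℝ × ℝ) × ℝ`. -/
def trilinearIntegrand (K : ℝ × ℝ → ℝ → ℂ) (F G H : ℝ × ℝ → ℂ) (q : (ℝ × ℝ) × ℝ) : ℂ :=
  K q.1 q.2 * F (q.1.2, q.2) * G (q.1.1, q.2) * H q.1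

theorem measurable_trilinearIntegrand {K : ℝ × ℝ → ℝ → ℂ} {F G H : ℝ × ℝ → ℂ}
    (hK : Measurable (Function.uncurry K)) (hF : Measurable F) (hG : Measurable G)
    (hH : Measurable H) : Measurable (trilinearIntegrand K F G H) :=
  (measurable_trilinear_inner hK hF hG).mul (hH.comp measurable_fst)

/-- A qualitative Loomis-Whitney inequality on finite measure spaces. -/
theorem lintegral_mul_mul_lt_top {μ ν ρ : Measure ℝ} [IsFiniteMeasure μ] [IsFiniteMeasure ν]
    [IsFiniteMeasure ρ] {F G H : ℝ × ℝ → ℝ≥0∞} (hF : Measurable F) (hG : Measurable G)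
    (hH : Measurable H) (hF' : ∫⁻ p, F p ^ 4 ∂(ν.prod ρ) ≠ ⊤)
    (hG' : ∫⁻ p, G p ^ 4 ∂(μ.prod ρ) ≠ ⊤) (hH' : ∫⁻ p, H p ^ 2 ∂(μ.prod ν) ≠ ⊤) :
    ∫⁻ q, F (q.1.2, q.2) * G (q.1.1, q.2) * H q.1 ∂((μ.prod ν).prod ρ) < ⊤ := by
  have mF : Measurable fun q : (ℝ × ℝ) × ℝ => F (q.1.2, q.2) := hF.comp (by fun_prop)
  have mG : Measurable fun q : (ℝ × ℝ) × ℝ => G (q.1.1, q.2) := hG.comp (by fun_prop)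
  have mH : Measurable fun q : (ℝ × ℝ) × ℝ => H q.1 := hH.comp (by fun_prop)
  -- Each function ignores one coordinate, and integrating over that coordinate costs only a finite
  -- total mass. Then FG is in L² by Cauchy-Schwarz, and pairing it with H in L² is finite.
  have iF : ∫⁻ q, F (q.1.2, q.2) ^ 4 ∂((μ.prod ν).prod ρ) < ⊤ := by
    rw [lintegral_prod _ (mF.pow_const 4).aemeasurable,
      lintegral_prod _ (mF.pow_const 4).lintegral_prod_right'.aemeasurable]
    simp only
    rw [lintegral_const, ← lintegral_prod _ (hF.pow_const 4).aemeasurable]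
    exact ENNReal.mul_lt_top hF'.lt_top (measure_lt_top _ _)
  have iG : ∫⁻ q, G (q.1.1, q.2) ^ 4 ∂((μ.prod ν).prod ρ) < ⊤ := by
    rw [lintegral_prod _ (mG.pow_const 4).aemeasurable,
      lintegral_prod _ (mG.pow_const 4).lintegral_prod_right'.aemeasurable]
    simp only [lintegral_const]
    rw [lintegral_mul_const' _ _ (measure_ne_top _ _),
      ← lintegral_prod _ (hG.pow_const 4).aemeasurable]
    exact ENNReal.mul_lt_top hG'.lt_top (measure_lt_top _ _)
  have iH : ∫⁻ q, H q.1 ^ 2 ∂((μ.prod ν).prod ρ) < ⊤ := by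
    rw [lintegral_prod _ (mH.pow_const 2).aemeasurable]
    simp only [lintegral_const]
    rw [lintegral_mul_const' _ _ (measure_ne_top _ _)]
    exact ENNReal.mul_lt_top hH'.lt_top (measure_lt_top _ _)
  have h1 := lintegral_sq_le_of_sq_le_mul (μ := (μ.prod ν).prod ρ)
    (w := fun q => F (q.1.2, q.2) ^ 2 * G (q.1.1, q.2) ^ 2) (mF.pow_const 4).aemeasurable
    (mG.pow_const 4).aemeasurable (Filter.Eventually.of_forall fun q => le_of_eq (by ring))
  have h2 := lintegral_sq_le_of_sq_le_mul (μ := (μ.prod ν).prod ρ)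
    (w := fun q => F (q.1.2, q.2) * G (q.1.1, q.2) * H q.1)
    ((mF.pow_const 2).mul (mG.pow_const 2)).aemeasurable
    (mH.pow_const 2).aemeasurable (Filter.Eventually.of_forall fun q => le_of_eq (by
      simp only [Pi.mul_apply]; ring))
  have h3 : ∫⁻ q, F (q.1.2, q.2) ^ 2 * G (q.1.1, q.2) ^ 2 ∂((μ.prod ν).prod ρ) < ⊤ :=
    (ENNReal.pow_lt_top_iff.1 (h1.trans_lt (ENNReal.mul_lt_top iF iG))).resolve_right two_ne_zero
  exact (ENNReal.pow_lt_top_iff.1 (h2.trans_lt (ENNReal.mul_lt_top h3 iH))).resolve_right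
    two_ne_zero

theorem integrable_trilinearIntegrand {K : ℝ × ℝ → ℝ → ℂ} {F G H : ℝ × ℝ → ℂ}
    (hK : Measurable (Function.uncurry K)) (hF : Measurable F) (hG : Measurable G)
    (hH : Measurable H) {M : ℝ} (hM : ∀ p z, ‖K p z‖ ≤ M) {I J L : Set ℝ}
    (hI : volume I ≠ ⊤) (hJ : volume J ≠ ⊤) (hL : volume L ≠ ⊤)
    (hsupp : ∀ p z, K p z ≠ 0 → (p, z) ∈ (I ×ˢ J) ×ˢ L)
    (hF' : ∫⁻ p, ‖F p‖ₑ ^ 4 ≠ ⊤) (hG' : ∫⁻ p, ‖G p‖ₑ ^ 4 ≠ ⊤) (hH' : ∫⁻ p, ‖H p‖ₑ ^ 2 ≠ ⊤) :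
    Integrable (trilinearIntegrand K F G H) := by
  have : IsFiniteMeasure (volume.restrict I) := ⟨by simpa using hI.lt_top⟩
  have : IsFiniteMeasure (volume.restrict J) := ⟨by simpa using hJ.lt_top⟩
  have : IsFiniteMeasure (volume.restrict L) := ⟨by simpa using hL.lt_top⟩
  rw [← integrableOn_iff_integrable_of_support_subset (s := (I ×ˢ J) ×ˢ L)
    (fun q hq => hsupp q.1 q.2 fun h0 => hq (by simp [trilinearIntegrand, h0]))]
  refine ⟨(measurable_trilinearIntegrand hK hF hG hH).aestronglyMeasurable, ?_⟩
  rw [Measure.volume_eq_prod, Measure.volume_eq_prod, ← Measure.prod_restrict,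
    ← Measure.prod_restrict]
  have hle : ∀ {f : ℝ × ℝ → ℝ≥0∞} (A B : Set ℝ), ∫⁻ p, f p ≠ ⊤ →
      ∫⁻ p, f p ∂((volume.restrict A).prod (volume.restrict B)) ≠ ⊤ := fun A B hf => by
    rw [Measure.prod_restrict]
    exact ((setLIntegral_le_lintegral _ _).trans_lt hf.lt_top).ne
  have key := lintegral_mul_mul_lt_top hF.enorm hG.enorm hH.enorm (hle J L hF') (hle I L hG')
    (hle I J hH')
  refine lt_of_le_of_lt (b := ENNReal.ofReal M * _) ?_
    (ENNReal.mul_lt_top ENNReal.ofReal_lt_top key)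
  rw [← lintegral_const_mul' _ _ ENNReal.ofReal_ne_top]
  refine lintegral_mono fun q => ?_
  simp only [trilinearIntegrand, enorm_mul, mul_assoc]
  refine mul_le_mul_left ?_ _
  rw [← ofReal_norm]
  exact ENNReal.ofReal_le_ofReal (hM _ _)

theorem integral_trilinearIntegrand {K : ℝ × ℝ → ℝ → ℂ} {F G H : ℝ × ℝ → ℂ}
    (hint : Integrable (trilinearIntegrand K F G H)) {I J L : Set ℝ}
    (hsupp : ∀ p z, K p z ≠ 0 → (p, z) ∈ (I ×ˢ J) ×ˢ L) :
    ∫ q, trilinearIntegrand K F G H q = trilinearForm (volume.restrict I) (volume.restrict J)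
      (volume.restrict L) K F G H := by
  rw [← setIntegral_eq_integral_of_forall_compl_eq_zero (s := (I ×ˢ J) ×ˢ L) fun q hq => by
    have : K q.1 q.2 = 0 := by_contra fun h0 => hq (hsupp _ _ h0)
    simp [trilinearIntegrand, this]]
  have hint' := hint.integrableOn (s := (I ×ˢ J) ×ˢ L)
  rw [IntegrableOn, Measure.volume_eq_prod, Measure.volume_eq_prod, ← Measure.prod_restrict,
    ← Measure.prod_restrict] at hint'
  rw [Measure.volume_eq_prod, Measure.volume_eq_prod, ← Measure.prod_restrict,
    ← Measure.prod_restrict, integral_prod _ hint', trilinearForm]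
  simp only [trilinearIntegrand, integral_mul_const]

/-- Truncation of `F` to the set where `‖F‖ ≤ n`. -/
noncomputable def truncateAt (n : ℕ) (F : ℝ × ℝ → ℂ) : ℝ × ℝ → ℂ := {p | ‖F p‖ ≤ n}.indicator F

theorem measurable_truncateAt {F : ℝ × ℝ → ℂ} (hF : Measurable F) (n : ℕ) :
    Measurable (truncateAt n F) :=
  hF.indicator (measurableSet_le hF.norm measurable_const)

theorem norm_truncateAt_le (n : ℕ) (F : ℝ × ℝ → ℂ) (p : ℝ × ℝ) : ‖truncateAt n F p‖ ≤ n := by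
  by_cases h : ‖F p‖ ≤ n
  · rwa [truncateAt, Set.indicator_of_mem (by exact h)]
  · rw [truncateAt, Set.indicator_of_notMem (by exact h), norm_zero]; positivity

theorem norm_truncateAt_le_norm (n : ℕ) (F : ℝ × ℝ → ℂ) (p : ℝ × ℝ) :
    ‖truncateAt n F p‖ ≤ ‖F p‖ :=
  norm_indicator_le_norm_self _ _

theorem eventually_truncateAt_eq (F : ℝ × ℝ → ℂ) (p : ℝ × ℝ) :
    ∀ᶠ n : ℕ in Filter.atTop, truncateAt n F p = F p := by
  obtain ⟨N, hN⟩ := exists_nat_ge ‖F p‖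
  filter_upwards [Filter.eventually_ge_atTop N] with n hn
  have hp : p ∈ {p | ‖F p‖ ≤ n} := hN.trans (by exact_mod_cast hn)
  exact Set.indicator_of_mem hp F

/-- Dominated convergence: truncation never increases the modulus, and at each point it is
eventually inactive. -/
theorem tendsto_integral_truncateAt {K : ℝ × ℝ → ℝ → ℂ} {F G H : ℝ × ℝ → ℂ}
    (hK : Measurable (Function.uncurry K)) (hF : Measurable F) (hG : Measurable G)
    (hH : Measurable H) (hint : Integrable (trilinearIntegrand K F G H)) :
    Filter.Tendsto (fun n => ∫ q, trilinearIntegrand K (truncateAt n F) (truncateAt n G)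
      (truncateAt n H) q) Filter.atTop (nhds (∫ q, trilinearIntegrand K F G H q)) := by
  refine tendsto_integral_of_dominated_convergence (fun q => ‖trilinearIntegrand K F G H q‖)
    (fun n => (measurable_trilinearIntegrand hK (measurable_truncateAt hF n)
      (measurable_truncateAt hG n) (measurable_truncateAt hH n)).aestronglyMeasurable)
    hint.norm (fun n => Filter.Eventually.of_forall fun q => ?_)
    (Filter.Eventually.of_forall fun q => ?_)
  · simp only [trilinearIntegrand, norm_mul]
    gcongr
    all_goals exact norm_truncateAt_le_norm _ _ _
  · refine tendsto_const_nhds.congr' ?_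
    filter_upwards [eventually_truncateAt_eq F (q.1.2, q.2),
      eventually_truncateAt_eq G (q.1.1, q.2), eventually_truncateAt_eq H q.1] with n h1 h2 h3
    simp only [trilinearIntegrand, h1, h2, h3]

namespace AdmissiblePair

variable {S : (Fin 3 → ℝ) → ℝ} {ψ : (Fin 3 → ℝ) → ℂ} {Ω : Set (Fin 3 → ℝ)} {a b : Fin 3 → ℝ}
  {μ C₁ C₂ : ℝ}

theorem oscKernel_support (h : AdmissiblePair S ψ Ω a b μ C₁ C₂) (lam : ℝ) (p : ℝ × ℝ) (z : ℝ)
    (hne : oscKernel lam S ψ id p z ≠ 0) :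
    (p, z) ∈ (Set.Icc (a 0) (a 0 + b 0) ×ˢ Set.Icc (a 1) (a 1 + b 1)) ×ˢ
      Set.Icc (a 2) (a 2 + b 2) := by
  have hψ : ψ ![p.1, p.2, z] ≠ 0 := fun h0 => hne (by simp [oscKernel, h0])
  have := h.tsupport_subset_Icc (subset_tsupport _ (Function.mem_support.2 hψ))
  exact ⟨⟨⟨this.1 0, this.2 0⟩, ⟨this.1 1, this.2 1⟩⟩, ⟨this.1 2, this.2 2⟩⟩

/-- The main estimate on `(ℝ × ℝ) × ℝ`. -/
theorem integrable_and_norm_integral_le (h : AdmissiblePair S ψ Ω a b μ C₁ C₂) (hC₁ : 0 < C₁)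
    (hC₂ : 0 ≤ C₂) {M lam : ℝ} (hlam : lam ≠ 0) (hM0 : 0 < M)
    (hM : ∀ z, ‖levelCutoff z‖ ≤ M ∧
      ‖fderiv ℝ levelCutoff z‖ ≤ M ∧ ‖fderiv ℝ (fderiv ℝ levelCutoff) z‖ ≤ M)
    {F G H : ℝ × ℝ → ℂ} {A B D : ℝ} (hF : Measurable F) (hG : Measurable G) (hH : Measurable H)
    (hA : 0 ≤ A) (hB : 0 ≤ B) (hD : 0 ≤ D) (hFA : ∫⁻ p, ‖F p‖ₑ ^ 4 ≤ ENNReal.ofReal (A ^ 4))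
    (hGB : ∫⁻ p, ‖G p‖ₑ ^ 4 ≤ ENNReal.ofReal (B ^ 4))
    (hHD : ∫⁻ p, ‖H p‖ₑ ^ 2 ≤ ENNReal.ofReal (D ^ 2)) :
    Integrable (trilinearIntegrand (oscKernel lam S ψ id) F G H) ∧
    ‖∫ q, trilinearIntegrand (oscKernel lam S ψ id) F G H q‖ ≤
    ((1 + 4 * C₂ + 3 * C₂ ^ 2) * (M * C₁) ^ 4 * (52428800 * Real.pi)) ^ (1 / 4 : ℝ) *
      (1 - (1 / 2 : ℝ) ^ (1 / 4 : ℝ))⁻¹ * (b 2 / (|lam| * μ)) ^ (1 / 4 : ℝ) * (A * B * D) := by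
  have hK := h.measurable_oscKernel lam continuous_id rfl
  have hfin : ∀ {F G H : ℝ × ℝ → ℂ}, Measurable F → Measurable G → Measurable H →
      ∫⁻ p, ‖F p‖ₑ ^ 4 ≤ ENNReal.ofReal (A ^ 4) → ∫⁻ p, ‖G p‖ₑ ^ 4 ≤ ENNReal.ofReal (B ^ 4) →
      ∫⁻ p, ‖H p‖ₑ ^ 2 ≤ ENNReal.ofReal (D ^ 2) →
      Integrable (trilinearIntegrand (oscKernel lam S ψ id) F G H) :=
    fun hF hG hH hFA hGB hHD => integrable_trilinearIntegrand hK hF hG hH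
      (norm_oscKernel_le h.norm_le) (by simp) (by simp) (by simp) (h.oscKernel_support lam)
      (hFA.trans_lt ENNReal.ofReal_lt_top).ne (hGB.trans_lt ENNReal.ofReal_lt_top).ne
      (hHD.trans_lt ENNReal.ofReal_lt_top).ne
  have hint := hfin hF hG hH hFA hGB hHD
  refine ⟨hint, le_of_tendsto (tendsto_integral_truncateAt hK hF hG hH hint).norm
    (Filter.Eventually.of_forall fun n => ?_)⟩
  have hmono : ∀ (F : ℝ × ℝ → ℂ) (k : ℕ), ∫⁻ p, ‖truncateAt n F p‖ₑ ^ k ≤ ∫⁻ p, ‖F p‖ₑ ^ k :=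
    fun F k => lintegral_mono fun p => pow_le_pow_left'
      (enorm_le_iff_norm_le.2 (norm_truncateAt_le_norm n F p)) k
  have hFn := (hmono F 4).trans hFA
  have hGn := (hmono G 4).trans hGB
  have hHn := (hmono H 2).trans hHD
  -- The support gives closed intervals while the cells are half-open; in x and z the two differ by
  -- null sets.
  rw [integral_trilinearIntegrand (hfin (measurable_truncateAt hF n) (measurable_truncateAt hG n)
    (measurable_truncateAt hH n) hFn hGn hHn) (h.oscKernel_support lam),
    ← Measure.restrict_congr_set Ioc_ae_eq_Icc,
    ← Measure.restrict_congr_set (Ioc_ae_eq_Icc (a := a 2))]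
  refine h.norm_trilinearForm_le hC₁ hC₂ hlam hM0 hM (measurable_truncateAt hF n)
    (measurable_truncateAt hG n) (measurable_truncateAt hH n) (norm_truncateAt_le n F)
    (norm_truncateAt_le n G) (norm_truncateAt_le n H) (by positivity) ?_
  refine (mul_le_mul' (mul_le_mul' (pow_le_pow_left' hHn 2) hFn) hGn).trans (le_of_eq ?_)
  rw [← ENNReal.ofReal_pow (by positivity), ← ENNReal.ofReal_mul (by positivity),
    ← ENNReal.ofReal_mul (by positivity)]
  congr 1; ring

end AdmissiblePair

/-! ### Transfer to functions on `Fin 3 → ℝ` -/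

/-- The measurable equivalence `(x, y) ↦ ![x, y]`. -/
def pairEquiv : ℝ × ℝ ≃ᵐ (Fin 2 → ℝ) := MeasurableEquiv.finTwoArrow.symm

theorem pairEquiv_apply (p : ℝ × ℝ) : pairEquiv p = ![p.1, p.2] := rfl

theorem measurePreserving_pairEquiv : MeasurePreserving pairEquiv :=
  (volume_preserving_finTwoArrow ℝ).symm _

/-- The measurable equivalence `((x, y), z) ↦ ![x, y, z]`. -/
def tripleEquiv : (ℝ × ℝ) × ℝ ≃ᵐ (Fin 3 → ℝ) :=
  ((pairEquiv.prodCongr (MeasurableEquiv.refl ℝ)).trans MeasurableEquiv.prodComm).trans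
    (MeasurableEquiv.piFinSuccAbove (fun _ => ℝ) (Fin.last 2)).symm

theorem tripleEquiv_apply (q : (ℝ × ℝ) × ℝ) : tripleEquiv q = ![q.1.1, q.1.2, q.2] := by
  ext i
  fin_cases i <;> rfl

theorem measurePreserving_tripleEquiv : MeasurePreserving tripleEquiv :=
  ((volume_preserving_piFinSuccAbove (fun _ : Fin 3 => ℝ) (Fin.last 2)).symm _).comp
    (Measure.measurePreserving_swap.comp
      (measurePreserving_pairEquiv.prod (MeasurePreserving.id volume)))

theorem lintegral_enorm_pow_pairEquiv {g f : (Fin 2 → ℝ) → ℂ} (hgf : f =ᵐ[volume] g)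
    {k : ℕ} (hk : k ≠ 0) (hf : MemLp f k volume) :
    ∫⁻ p, ‖g (pairEquiv p)‖ₑ ^ k = ENNReal.ofReal ((eLpNorm f k volume).toReal ^ k) := by
  rw [measurePreserving_pairEquiv.lintegral_comp_emb pairEquiv.measurableEmbedding
    (fun v => ‖g v‖ₑ ^ k), eLpNorm_congr_ae hgf, ENNReal.ofReal_pow ENNReal.toReal_nonneg,
    ENNReal.ofReal_toReal ((memLp_congr_ae hgf).1 hf).eLpNorm_ne_top]
  have := eLpNorm_nnreal_pow_eq_lintegral (f := g) (μ := volume) (p := (k : NNReal))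
    (by exact_mod_cast hk)
  simpa using this.symm

/-- Deleting a coordinate is a measure-preserving splitting followed by a projection, so preimages
of null sets are null. -/
theorem ae_removeNth_eq {f g : (Fin 2 → ℝ) → ℂ} (hfg : f =ᵐ[volume] g)
    (j : Fin 3) : ∀ᵐ v : Fin 3 → ℝ, f (j.removeNth v) = g (j.removeNth v) := by
  have h1 : Measure.QuasiMeasurePreserving (fun v : Fin 3 → ℝ => j.removeNth v) :=
    Measure.quasiMeasurePreserving_snd.comp
      (volume_preserving_piFinSuccAbove (fun _ : Fin 3 => ℝ) j).quasiMeasurePreserving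
  exact h1.ae hfg

theorem loomisWhitneyIntegrand_tripleEquiv (lam : ℝ) (S : (Fin 3 → ℝ) → ℝ)
    (ψ : (Fin 3 → ℝ) → ℂ) (g : Fin 3 → (Fin 2 → ℝ) → ℂ) (q : (ℝ × ℝ) × ℝ) :
    loomisWhitneyIntegrand lam S ψ g (tripleEquiv q) =
      trilinearIntegrand (oscKernel lam S ψ id) (fun p => g 0 (pairEquiv p))
        (fun p => g 1 (pairEquiv p)) (fun p => g 2 (pairEquiv p)) q := by
  have e0 : (0 : Fin 3).removeNth (tripleEquiv q) = pairEquiv (q.1.2, q.2) := by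
    rw [tripleEquiv_apply, pairEquiv_apply]; ext i; fin_cases i <;> rfl
  have e1 : (1 : Fin 3).removeNth (tripleEquiv q) = pairEquiv (q.1.1, q.2) := by
    rw [tripleEquiv_apply, pairEquiv_apply]; ext i; fin_cases i <;> rfl
  have e2 : (2 : Fin 3).removeNth (tripleEquiv q) = pairEquiv q.1 := by
    rw [tripleEquiv_apply, pairEquiv_apply]; ext i; fin_cases i <;> rfl
  rw [loomisWhitneyIntegrand, Fin.prod_univ_three, e0, e1, e2, trilinearIntegrand, oscKernel,
    tripleEquiv_apply, id]
  ring

theorem mainTheorem10 (C₁ C₂ : ℝ) (hC₁ : 0 < C₁) (hC₂ : 0 < C₂) :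
    ∃ C : ℝ, 0 < C ∧
      ∀ (S : (Fin 3 → ℝ) → ℝ) (ψ : (Fin 3 → ℝ) → ℂ) (Ω : Set (Fin 3 → ℝ))
        (b : Fin 3 → ℝ) (μ lam : ℝ),
        ContDiff ℝ ∞ ψ → HasCompactSupport ψ →
        IsOpen Ω → tsupport ψ ⊆ Ω → ContDiffOn ℝ ∞ S Ω →
        (∀ j, 0 < b j) → 0 < μ → lam ≠ 0 →
        (∃ a : Fin 3 → ℝ, tsupport ψ ⊆ Set.Icc a (a + b)) →
        (∀ j, LocalEstimateHypotheses S ψ j (b j) μ C₁ C₂) →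
        ∀ f : Fin 3 → (Fin 2 → ℝ) → ℂ,
          MemLp (f 0) 4 volume → MemLp (f 1) 4 volume → MemLp (f 2) 2 volume →
          Integrable (loomisWhitneyIntegrand lam S ψ f) volume ∧
          ‖loomisWhitneyForm lam S ψ f‖ ≤
            C * b 2 ^ (1 / 4 : ℝ) * (|lam| * μ) ^ (-(1 / 4) : ℝ) *
              (eLpNorm (f 0) 4 volume).toReal * (eLpNorm (f 1) 4 volume).toReal *
              (eLpNorm (f 2) 2 volume).toReal := by
  obtain ⟨M, hM0, hM⟩ :=
    contDiff_levelCutoff.exists_bound_fderiv_fderiv hasCompactSupport_levelCutoff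
  have hr1 : (1 / 2 : ℝ) ^ (1 / 4 : ℝ) < 1 :=
    Real.rpow_lt_one (by norm_num) (by norm_num) (by norm_num)
  refine ⟨((1 + 4 * C₂ + 3 * C₂ ^ 2) * (M * C₁) ^ 4 * (52428800 * Real.pi)) ^ (1 / 4 : ℝ) *
      (1 - (1 / 2 : ℝ) ^ (1 / 4 : ℝ))⁻¹,
    mul_pos (by positivity) (inv_pos.2 (sub_pos.2 hr1)), ?_⟩
  rintro S ψ Ω b μ lam hψ - hΩ hsub hS hb hμ hlam ⟨a, ha⟩ hloc f hf0 hf1 hf2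
  have h : AdmissiblePair S ψ Ω a b μ C₁ C₂ := ⟨hψ, hΩ, hsub, hS, hb, hμ, ha, hloc⟩
  have hsm : ∀ j, AEStronglyMeasurable (f j) volume := by
    intro j
    fin_cases j
    exacts [hf0.1, hf1.1, hf2.1]
  -- The iterated integrals above require genuinely measurable functions, so each f j is replaced by
  -- a measurable representative; neither the integral nor the norms change.
  set g : Fin 3 → (Fin 2 → ℝ) → ℂ := fun j => (hsm j).mk (f j) with hg
  have hgm : ∀ j, Measurable fun p => g j (pairEquiv p) := fun j =>
    (hsm j).stronglyMeasurable_mk.measurable.comp pairEquiv.measurable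
  have hfg : ∀ j, f j =ᵐ[volume] g j := fun j => (hsm j).ae_eq_mk
  obtain ⟨hint, hbound⟩ := h.integrable_and_norm_integral_le hC₁ hC₂.le hlam hM0 hM
    (hgm 0) (hgm 1) (hgm 2) ENNReal.toReal_nonneg ENNReal.toReal_nonneg ENNReal.toReal_nonneg
    (lintegral_enorm_pow_pairEquiv (hfg 0) (k := 4) (by norm_num) hf0).le
    (lintegral_enorm_pow_pairEquiv (hfg 1) (k := 4) (by norm_num) hf1).le
    (lintegral_enorm_pow_pairEquiv (hfg 2) (k := 2) (by norm_num) hf2).le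
  have hae : loomisWhitneyIntegrand lam S ψ f =ᵐ[volume] loomisWhitneyIntegrand lam S ψ g := by
    filter_upwards [ae_removeNth_eq (hfg 0) 0, ae_removeNth_eq (hfg 1) 1,
      ae_removeNth_eq (hfg 2) 2] with v h0 h1 h2
    have hj : ∀ j : Fin 3, f j (j.removeNth v) = g j (j.removeNth v) := fun j => by
      fin_cases j
      exacts [h0, h1, h2]
    simp only [loomisWhitneyIntegrand]
    rw [Finset.prod_congr rfl fun j _ => hj j]
  have hcomp : loomisWhitneyIntegrand lam S ψ g ∘ tripleEquiv =
      trilinearIntegrand (oscKernel lam S ψ id) (fun p => g 0 (pairEquiv p))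
        (fun p => g 1 (pairEquiv p)) (fun p => g 2 (pairEquiv p)) :=
    funext (loomisWhitneyIntegrand_tripleEquiv lam S ψ g)
  constructor
  · rw [integrable_congr hae,
      ← measurePreserving_tripleEquiv.integrable_comp_emb tripleEquiv.measurableEmbedding, hcomp]
    exact hint
  · rw [loomisWhitneyForm, integral_congr_ae hae,
      ← measurePreserving_tripleEquiv.integral_comp tripleEquiv.measurableEmbedding]
    simp only [loomisWhitneyIntegrand_tripleEquiv]
    refine hbound.trans (le_of_eq ?_)
    rw [Real.div_rpow (hb 2).le (by positivity), Real.rpow_neg (by positivity)]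
    push_cast
    ring
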